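/- **Setting.** Let $\mathbb K=\mathbb R$ or $\mathbb C$, let $U\subseteq\mathbb R^d$ be open with coordinates $x^i$, and let $(x^i,p_i)$ be the induced coordinates on $T^*U$; write $\partial_i=\partial/\partial x^i$, $\tilde\partial^i=\partial/\partial p_i$ and $\pi:T^*U\to U$. Functions are smooth and $\mathbb K$-valued; the subscript "pol" means polynomial on the fibres, and $[[t]]$ denotes formal power series in $t$. Let $\theta=\frac12\theta^{ij}\partial_i\wedge\partial_j$ be an arbitrary bivector on $U$ (an almost Poisson structure), with $\{f,g\}_\theta=\theta^{ij}\partial_if\,\partial_jg$. A *local symplectic embedding* of $(U,\theta)$ is a closed two-form $\omega\in\Omega^2_{\rm pol}(T^*U)[[t]]$ with $\omega|_{t=0}=dp_i\wedge dx^i$, such that the zero section is Lagrangian, $\{\pi^*f,\pi^*g\}_{\omega^{-1}}|_{p=0}=t\{f,g\}_\theta$ for all $f,g\in C^\infty(U)$, and the bivector $\omega^{-1}$ has the local form $\{x^i,x^j\}_{\omega^{-1}}=t\,\big(\theta^{ij}(x)+O(t)\big)$ on $T^*U$. The sign convention is $\{x^i,p_j\}_{\omega^{-1}}|_{t=0}=\delta^i_j$.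 For a gauge field $A=A_i\,dx^i\in\Omega^1(U)$ put $s_A(x)=(x,A(x))$ and $(\Phi_A)_i=p_i-A_i(x)$. Field dependent quantities are formal power series in $t$ whose coefficients are differential functions of $A$, i.e. functions of $x$, $A$ and finitely many derivatives of $A$, smooth in $x$ and polynomial in $A$ and its derivatives; those in $C^\infty_{\rm pol}(J^1T^*U)[[t]]$ involve only $x$, $A$ and $\partial A$. In brackets such quantities are pulled back to $T^*U$ as functions of $x$ through $A(x)$ and its derivatives. For a functional $\mathcal F$ of $A$ and a variation $A\mapsto A+\delta A$, $\delta\mathcal F(A)$ denotes the part of $\mathcal F(A+\delta A)-\mathcal F(A)$ that is linear in $\delta A$ (the first variation), and $\mathbb 1+\delta$ acts on functionals by $\mathcal F\mapsto\mathcal F+\delta\mathcal F$. **Data.** Let $L^{ij}\in C^\infty_{\rm pol}(J^1T^*U)[[t]]$ with $L^{ij}|_{t=0}=0$, and let $L_f=L_f^i\,\partial_i$ with $L_f^i=L^{ij}\,\partial_jf$ be the corresponding horizontal vector fields, for (possibly field dependent) gauge parameters $f$, and $\Phi_A(L_f)=L_f^i\,(\Phi_A)_i$. Define $$\delta_fA_i=s_A^*\{\pi^*f+\Phi_A(L_f),(\Phi_A)_i\}_{\omega^{-1}},\qquad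 t\,[\![f,g]\!](A)=s_A^*\{\pi^*f,\pi^*g\}_{\omega^{-1}}-s_A^*\{\Phi_A(L_f),\Phi_A(L_g)\}_{\omega^{-1}} .$$ Suppose that for all $f,g\in C^\infty(U)$, all $A\in\Omega^1(U)$ and all $i$ $$\begin{aligned}L^i_{t[\![f,g]\!](A)}&=\delta_fL^i_g-\delta_gL^i_f+s_A^*\big(\tilde\partial^i\{\pi^*f,\pi^*g\}_{\omega^{-1}}\big)+L_f^jL_g^k\,s_A^*\big(\tilde\partial^i\{(\Phi_A)_j,(\Phi_A)_k\}_{\omega^{-1}}\big)\\&\quad+s_A^*\{\pi^*f,L_g^i\}_{\omega^{-1}}-s_A^*\{\pi^*g,L_f^i\}_{\omega^{-1}}+s_A^*\{L_f^i,\Phi_A(L_g)\}_{\omega^{-1}}-s_A^*\{L_g^i,\Phi_A(L_f)\}_{\omega^{-1}}\\&\quad+L_g^j\,s_A^*\big(\tilde\partial^i\{\pi^*f,(\Phi_A)_j\}_{\omega^{-1}}\big)-L_f^j\,s_A^*\big(\tilde\partial^i\{\pi^*g,(\Phi_A)_j\}_{\omega^{-1}}\big).\end{aligned}$$ **Proposition.**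 The right-hand side of the formula for $t[\![f,g]\!]$ is divisible by $t$ for $f,g\in C^\infty(U)$, so $[\![f,g]\!]$ is well defined, and $(f,A)\mapsto A+\delta_fA$ is an almost Poisson gauge transformation with bracket $[\![\cdot,\cdot]\!]$. That is, for all $f,g,h\in C^\infty(U)$ and $A\in\Omega^1(U)$: 1. The components of $\delta_fA$ lie in $C^\infty_{\rm pol}(J^1T^*U)[[t]]$; $f\mapsto\delta_fA$ is $\mathbb K$-linear, $\delta_fA|_{t=0}=df$, and $\delta_{fg}A=g\,\delta_fA+f\,\delta_gA$. 2. $[\mathbb 1+\delta_f,\mathbb 1+\delta_g]A=\delta_{t[\![f,g]\!](A)}A$. 3. $[\![f,g]\!]\in C^\infty_{\rm pol}(J^1T^*U)[[t]]$; $[\![\cdot,\cdot]\!]$ is $\mathbb K$-bilinear and skew-symmetric on $C^\infty(U)$, $[\![f,g]\!]|_{t=0}=\{f,g\}_\theta$, and $$\mathrm{Cyc}_{f,g,h}\Big(t\,\big[\![h,[\![f,g]\!](A)]\!\big](A)+\delta_h[\![f,g]\!](A)\Big)=0 .$$ 4. For fixed $f$, the map $[\![f,\cdot]\!]$ is a $\mathbb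 K$-linear derivation on field dependent gauge parameters (with values in field dependent quantities). -/

import Mathlib

open scoped ContDiff Manifold
open TopologicalSpace (Opens)

namespace AlmostPoissonGauge

noncomputable section

/-! ### Smooth functions on a coordinate chart and their formal extensions -/

/-- The commutative `𝕜`-algebra `C^∞(U)` of smooth `𝕜`-valued functions (`𝕜 = ℝ` or `ℂ`) on an
open subset `U` of `ℝ^d`. -/
def smoothAlg (𝕜 : Type) [RCLike 𝕜] {d : ℕ} (U : Opens (EuclideanSpace ℝ (Fin d))) :
    Subalgebra 𝕜 (U → 𝕜) where
  carrier := {f | ContMDiff 𝓘(ℝ, EuclideanSpace ℝ (Fin d)) 𝓘(ℝ, 𝕜) ∞ f}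
  mul_mem' := by
    intro f g hf hg
    have hm : ContDiff ℝ ∞ (fun p : 𝕜 × 𝕜 => p.1 * p.2) := contDiff_fst.mul contDiff_snd
    exact hm.contMDiff.comp (hf.prodMk_space hg)
  add_mem' := by
    intro f g hf hg
    have hm : ContDiff ℝ ∞ (fun p : 𝕜 × 𝕜 => p.1 + p.2) := contDiff_fst.add contDiff_snd
    exact hm.contMDiff.comp (hf.prodMk_space hg)
  algebraMap_mem' := by
    intro r
    exact contMDiff_const

/-- The type of elements of `C^∞(U)`. -/
def SmoothFn (𝕜 : Type) [RCLike 𝕜] {d : ℕ} (U : Opens (EuclideanSpace ℝ (Fin d))) : Type :=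
  smoothAlg 𝕜 U

instance (𝕜 : Type) [RCLike 𝕜] {d : ℕ} (U : Opens (EuclideanSpace ℝ (Fin d))) :
    CommRing (SmoothFn 𝕜 U) :=
  inferInstanceAs (CommRing (smoothAlg 𝕜 U))

instance (𝕜 : Type) [RCLike 𝕜] {d : ℕ} (U : Opens (EuclideanSpace ℝ (Fin d))) :
    Algebra 𝕜 (SmoothFn 𝕜 U) :=
  inferInstanceAs (Algebra 𝕜 (smoothAlg 𝕜 U))

section Partial

variable {𝕜 : Type} [RCLike 𝕜] {d : ℕ} {U : Opens (EuclideanSpace ℝ (Fin d))}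

/-- Extension by zero of a function on `U` to all of `ℝ^d`. -/
def extendZero (f : U → 𝕜) : EuclideanSpace ℝ (Fin d) → 𝕜 := Function.extend Subtype.val f 0

theorem extendZero_coe (f : U → 𝕜) (x : U) : extendZero f x = f x :=
  Subtype.val_injective.extend_apply f 0 x

theorem contDiffAt_extendZero (f : SmoothFn 𝕜 U) (x : U) :
    ContDiffAt ℝ ∞ (extendZero f.1) (x : EuclideanSpace ℝ (Fin d)) := by
  rw [← contMDiffAt_iff_contDiffAt, ← contMDiffAt_subtype_iff]
  have h : (fun y : U => extendZero f.1 y) = f.1 := funext (extendZero_coe f.1)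
  rw [h]
  exact f.2 x

theorem differentiableAt_extendZero (f : SmoothFn 𝕜 U) (x : U) :
    DifferentiableAt ℝ (extendZero f.1) (x : EuclideanSpace ℝ (Fin d)) :=
  (contDiffAt_extendZero f x).differentiableAt (by simp)

theorem extendZero_eventuallyEq {f : U → 𝕜} {F : EuclideanSpace ℝ (Fin d) → 𝕜} (x : U)
    (h : ∀ y : U, f y = F y) :
    extendZero f =ᶠ[nhds (x : EuclideanSpace ℝ (Fin d))] F := by
  filter_upwards [U.isOpen.mem_nhds x.2] with y hy
  exact (extendZero_coe f ⟨y, hy⟩).trans (h ⟨y, hy⟩)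

/-- The derivation `∂_i = ∂/∂x^i` of `C^∞(U)`. -/
def pdDer (i : Fin d) : Derivation 𝕜 (SmoothFn 𝕜 U) (SmoothFn 𝕜 U) :=
  Derivation.mk'
    { toFun := fun f =>
        ⟨fun x => fderiv ℝ (extendZero f.1) (x : EuclideanSpace ℝ (Fin d))
            (EuclideanSpace.single i 1), by
          intro x
          have h1 : ContDiffAt ℝ ∞ (fun y : EuclideanSpace ℝ (Fin d) =>
              fderiv ℝ (extendZero f.1) y (EuclideanSpace.single i 1)) x :=
            ((contDiffAt_extendZero f x).fderiv_right (m := ∞) (by simp)).clm_apply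
              contDiffAt_const
          exact contMDiffAt_subtype_iff.2 (contMDiffAt_iff_contDiffAt.2 h1)⟩
      map_add' := by
        intro f g
        refine Subtype.ext (funext fun x => ?_)
        change fderiv ℝ (extendZero (f + g).1) x _ = _
        rw [(extendZero_eventuallyEq (F := extendZero f.1 + extendZero g.1) x (by
          intro y; simp only [Pi.add_apply, extendZero_coe]; rfl)).fderiv_eq,
          fderiv_add (differentiableAt_extendZero f x) (differentiableAt_extendZero g x)]
        rfl
      map_smul' := by
        intro c f
        refine Subtype.ext (funext fun x => ?_)
        change fderiv ℝ (extendZero (c • f).1) x _ = _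
        rw [(extendZero_eventuallyEq (F := fun y => c * extendZero f.1 y) x (by
          intro y; simp only [extendZero_coe]; rfl)).fderiv_eq,
          fderiv_const_mul (differentiableAt_extendZero f x)]
        rfl }
    (by
      intro f g
      refine Subtype.ext (funext fun x => ?_)
      change fderiv ℝ (extendZero (f * g).1) x _ = _
      rw [(extendZero_eventuallyEq (F := fun y => extendZero f.1 y * extendZero g.1 y) x (by
          intro y; simp only [extendZero_coe]; rfl)).fderiv_eq,
          fderiv_fun_mul (differentiableAt_extendZero f x) (differentiableAt_extendZero g x)]
      simp only [extendZero_coe]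
      rfl)

/-- The partial derivative `∂_i f`. -/
def pd (i : Fin d) (f : SmoothFn 𝕜 U) : SmoothFn 𝕜 U := pdDer (𝕜 := 𝕜) (U := U) i f

end Partial

/-- Apply a map to every coefficient of a formal power series in `t`. -/
def mapT {B C : Type} [CommRing B] [CommRing C] (D : B → C) (S : PowerSeries B) : PowerSeries C :=
  PowerSeries.mk fun n => D (PowerSeries.coeff n S)

/-- The quotient `S / t` of a formal power series `S` without constant term. -/
def divT {B : Type} [CommRing B] (S : PowerSeries B) : PowerSeries B :=
  PowerSeries.mk fun n => PowerSeries.coeff (n + 1) S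

section Algebras

variable (𝕜 : Type) [RCLike 𝕜] {d : ℕ} (U : Opens (EuclideanSpace ℝ (Fin d)))

/-- `C^∞_pol(T^*U)`: smooth functions on `T^*U` polynomial in the fibre coordinates `p_i`. -/
abbrev Phase : Type := MvPolynomial (Fin d) (SmoothFn 𝕜 U)

/-- Indices of the jet coordinates: `(i, α)` stands for `∂^α A_i`. -/
abbrev JetIdx (d : ℕ) : Type := Fin d × (Fin d →₀ ℕ)

/-- Differential functions `F(x, A(x), ∂A(x), ∂²A(x), …)` of a gauge field `A`, polynomial in
finitely many jet coordinates: functions on the jet spaces of `T^*U`. -/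
abbrev Jet : Type := MvPolynomial (JetIdx d) (SmoothFn 𝕜 U)

/-- Functions on `T^*U` which in addition depend on the jets of a gauge field; the variable
`Sum.inl i` is `p_i`. -/
abbrev JetPhase : Type := MvPolynomial (Fin d ⊕ JetIdx d) (SmoothFn 𝕜 U)

/-- Field dependent quantities, as formal power series in `t`. -/
abbrev FieldDep : Type := PowerSeries (Jet 𝕜 U)

end Algebras

section Core

variable {𝕜 : Type} [RCLike 𝕜] {d : ℕ} {U : Opens (EuclideanSpace ℝ (Fin d))}

/-- The derivation of the polynomial ring `C^∞(U)[X_v | v ∈ σ]` which is `∂_i` on the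
coefficients and sends the variable `X_v` to `s v`. -/
def extendD {σ : Type} (i : Fin d) (s : σ → MvPolynomial σ (SmoothFn 𝕜 U))
    (P : MvPolynomial σ (SmoothFn 𝕜 U)) : MvPolynomial σ (SmoothFn 𝕜 U) :=
  (∑ m ∈ P.support, MvPolynomial.monomial m (pd i (MvPolynomial.coeff m P))) +
    MvPolynomial.mkDerivation (SmoothFn 𝕜 U) s P

/-- `∂/∂z^a` on `C^∞_pol(T^*U)[[t]]`, where `z = (x, p)`: `Sum.inl i` is `x^i` and `Sum.inr i`
is `p_i`. -/
def phaseD : Fin d ⊕ Fin d → PowerSeries (Phase 𝕜 U) → PowerSeries (Phase 𝕜 U)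
  | Sum.inl i => mapT (extendD i 0)
  | Sum.inr i => mapT (MvPolynomial.pderiv i)

/-- The total derivative `D_i` of differential functions: `D_i (∂^α A_j) = ∂^(α + e_i) A_j`. -/
def totalD (i : Fin d) : FieldDep 𝕜 U → FieldDep 𝕜 U :=
  mapT (extendD i fun v => MvPolynomial.X (v.1, v.2 + Finsupp.single i 1))

/-- `∂/∂z^a` on functions on `T^*U` which depend on a gauge field `A(x)`: the derivative along
`x^i` also acts on `A` and its derivatives, and kills `p`. -/
def jetPhaseD : Fin d ⊕ Fin d → PowerSeries (JetPhase 𝕜 U) → PowerSeries (JetPhase 𝕜 U)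
  | Sum.inl i => mapT (extendD i (Sum.elim 0
      fun v => MvPolynomial.X (Sum.inr (v.1, v.2 + Finsupp.single i 1))))
  | Sum.inr i => mapT (MvPolynomial.pderiv (Sum.inl i))

/-- The composite `D^α = D_1^(α_1) ⋯ D_d^(α_d)` of given operators `D_i`. -/
def iterD {B : Type} (D : Fin d → B → B) (α : Fin d →₀ ℕ) (b : B) : B :=
  (List.finRange d).foldr (fun i c => (D i)^[α i] c) b

/-! ### Almost Poisson structures and symplectic embeddings -/

/-- An almost Poisson structure `θ = ½ θ^{ij} ∂_i ∧ ∂_j`: a bivector field on `U`. -/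
structure AlmostPoisson (𝕜 : Type) [RCLike 𝕜] {d : ℕ} (U : Opens (EuclideanSpace ℝ (Fin d))) where
  /-- the components `θ^{ij}` -/
  θ : Fin d → Fin d → SmoothFn 𝕜 U
  skew : ∀ i j, θ i j = -θ j i

/-- The almost Poisson bracket `{f, g}_θ = θ^{ij} ∂_i f ∂_j g`. -/
def AlmostPoisson.bracket (Θ : AlmostPoisson 𝕜 U) (f g : SmoothFn 𝕜 U) : SmoothFn 𝕜 U :=
  ∑ i, ∑ j, Θ.θ i j * pd i f * pd j g

/-- The matrix of the canonical symplectic form `ω₀ = dp_i ∧ dx^i`. -/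
def canonicalForm : Matrix (Fin d ⊕ Fin d) (Fin d ⊕ Fin d) (Phase 𝕜 U) :=
  Matrix.fromBlocks 0 (-1) 1 0

/-- The bracket `{F, G}_{ω⁻¹} = (ω⁻¹)^{ab} ∂_a F ∂_b G` on `C^∞_pol(T^*U)[[t]]`, where
`ω = ½ w_{ab} dz^a ∧ dz^b`. -/
def phaseBracket (w : Matrix (Fin d ⊕ Fin d) (Fin d ⊕ Fin d) (PowerSeries (Phase 𝕜 U)))
    (F G : PowerSeries (Phase 𝕜 U)) : PowerSeries (Phase 𝕜 U) :=
  ∑ a, ∑ b, w⁻¹ a b * phaseD a F * phaseD b G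

/-- The pullback `π^*f` of `f ∈ C^∞(U)` to `T^*U`. -/
def phasePull (f : SmoothFn 𝕜 U) : PowerSeries (Phase 𝕜 U) := PowerSeries.C (MvPolynomial.C f)

/-- Restriction to the zero section `p = 0` of `T^*U`. -/
def zeroSection : PowerSeries (Phase 𝕜 U) →+* PowerSeries (SmoothFn 𝕜 U) :=
  PowerSeries.map (MvPolynomial.eval fun _ => 0)

/-- A local symplectic embedding of `(U, θ)`: a formal symplectic form
`ω = ½ ω_{ab} dz^a ∧ dz^b` on `T^*U`, polynomial on the fibres. -/
structure SymplecticEmbedding (Θ : AlmostPoisson 𝕜 U) where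
  /-- the matrix `form = (ω_{ab})` -/
  form : Matrix (Fin d ⊕ Fin d) (Fin d ⊕ Fin d) (PowerSeries (Phase 𝕜 U))
  /-- `ω` is a two-form -/
  skew : ∀ a b, form a b = -form b a
  /-- `dω = 0` -/
  closed : ∀ a b c, phaseD a (form b c) + phaseD b (form c a) + phaseD c (form a b) = 0
  /-- `ω` at `t = 0` is `ω₀`; in particular `ω` is invertible -/
  deformation : ∀ a b, PowerSeries.constantCoeff (form a b) = canonicalForm a b
  /-- `{π^*f, π^*g}_{ω⁻¹}` restricts on the zero section to `t {f, g}_θ` -/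
  restricts : ∀ f g : SmoothFn 𝕜 U,
    zeroSection (phaseBracket form (phasePull f) (phasePull g)) =
      PowerSeries.X * PowerSeries.C (Θ.bracket f g)
  /-- the zero section is Lagrangian -/
  lagrangian : ∀ i j, zeroSection (form (Sum.inl i) (Sum.inl j)) = 0
  /-- the bivector `ω⁻¹` is in the local form `{x^i, x^j} = t (θ^{ij}(x) + O(t))` -/
  leading : ∀ i j, PowerSeries.coeff 1 (form⁻¹ (Sum.inl i) (Sum.inl j)) = MvPolynomial.C (Θ.θ i j)

/-! ### Field dependent quantities -/

/-- A field independent gauge parameter `f ∈ C^∞(U)`, seen as a field dependent one. -/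
def param (f : SmoothFn 𝕜 U) : FieldDep 𝕜 U := PowerSeries.C (MvPolynomial.C f)

/-- The component `A_i` of the gauge field, as a differential function. -/
def gaugeField (i : Fin d) : FieldDep 𝕜 U := PowerSeries.C (MvPolynomial.X (i, 0))

/-- The value `G(A) ∈ C^∞(U)[[t]]` of a differential function `G` at an actual gauge field
`A = A_i dx^i ∈ Ω^1(U)`: the jet coordinate `(i, α)` becomes `∂^α A_i`. -/
def evalAt (A : Fin d → SmoothFn 𝕜 U) : FieldDep 𝕜 U →+* PowerSeries (SmoothFn 𝕜 U) :=
  PowerSeries.map (MvPolynomial.eval fun v => iterD pd v.2 (A v.1))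

/-- `G ∈ C^∞_pol(J^1 T^*U)[[t]]`: only `x`, `A` and the first derivatives `∂A` occur. -/
def IsFirstOrder (G : FieldDep 𝕜 U) : Prop :=
  ∀ n, ∀ v ∈ (PowerSeries.coeff n G).vars, v.2.degree ≤ 1

/-- The (first order) variation of the functional `G` under `A ↦ A + Q`, that is the part of
`G(A + Q) - G(A)` linear in `Q`: `∑ (∂G / ∂(∂^α A_i)) D^α Q_i`. -/
def vary (Q : Fin d → FieldDep 𝕜 U) (G : FieldDep 𝕜 U) : FieldDep 𝕜 U :=
  PowerSeries.mk fun n => ∑ m ∈ Finset.HasAntidiagonal.antidiagonal n,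
    PowerSeries.coeff m.2 (MvPolynomial.mkDerivation (SmoothFn 𝕜 U)
      (fun v : JetIdx d => iterD totalD v.2 (Q v.1)) (PowerSeries.coeff m.1 G))

/-- The pullback `π^*` of field dependent functions on `U` to `T^*U`. -/
def pull : FieldDep 𝕜 U →+* PowerSeries (JetPhase 𝕜 U) :=
  PowerSeries.map (MvPolynomial.rename (R := SmoothFn 𝕜 U) Sum.inr).toRingHom

/-- Functions on `T^*U` as (field independent) functions on `T^*U`. -/
def ofPhase : PowerSeries (Phase 𝕜 U) →+* PowerSeries (JetPhase 𝕜 U) :=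
  PowerSeries.map (MvPolynomial.rename (R := SmoothFn 𝕜 U) Sum.inl).toRingHom

/-- The pullback `s_A^*` along the section `s_A(x) = (x, A(x))`, which puts `p_i = A_i(x)`. -/
def sA : PowerSeries (JetPhase 𝕜 U) →+* FieldDep 𝕜 U :=
  PowerSeries.map (MvPolynomial.aeval (R := SmoothFn 𝕜 U)
    (Sum.elim (fun i => MvPolynomial.X (i, 0)) MvPolynomial.X :
      Fin d ⊕ JetIdx d → Jet 𝕜 U)).toRingHom

/-- The constraint `(Φ_A)_i = p_i - A_i`. -/
def Phi (i : Fin d) : PowerSeries (JetPhase 𝕜 U) :=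
  PowerSeries.C (MvPolynomial.X (Sum.inl i)) - pull (gaugeField i)

/-- The fibre derivative `∂/∂p_i`. -/
def pDeriv (i : Fin d) (F : PowerSeries (JetPhase 𝕜 U)) : PowerSeries (JetPhase 𝕜 U) :=
  jetPhaseD (Sum.inr i) F

variable {Θ : AlmostPoisson 𝕜 U}

/-- The cosymplectic bracket `{F, G}_{ω⁻¹}` of functions on `T^*U` which depend on the gauge
field. -/
def SymplecticEmbedding.br (W : SymplecticEmbedding Θ) (F G : PowerSeries (JetPhase 𝕜 U)) :
    PowerSeries (JetPhase 𝕜 U) :=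
  ∑ a, ∑ b, ofPhase (W.form⁻¹ a b) * jetPhaseD a F * jetPhaseD b G

/-! ### Lagrangian multipliers, gauge variations and the field dependent bracket -/

/-- The components `L_f^i = L^{ij} ∂_j f` of the horizontal vector field `L_f`; for a field
dependent parameter `f` the derivative `∂_j f` is that of `x ↦ f(x, A(x), ∂A(x))`. -/
def multiplier (L : Fin d → Fin d → FieldDep 𝕜 U) (f : FieldDep 𝕜 U) (i : Fin d) :
    FieldDep 𝕜 U :=
  ∑ j, L i j * totalD j f

/-- `Φ_A(L_f) = L_f^i (Φ_A)_i`. -/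
def PhiL (L : Fin d → Fin d → FieldDep 𝕜 U) (f : FieldDep 𝕜 U) : PowerSeries (JetPhase 𝕜 U) :=
  ∑ i, pull (multiplier L f i) * Phi i

/-- The components of `δ_f A = s_A^*{π^*f + Φ_A(L_f), Φ_A}_{ω⁻¹}`. -/
def gaugeVariation (W : SymplecticEmbedding Θ) (L : Fin d → Fin d → FieldDep 𝕜 U)
    (f : FieldDep 𝕜 U) (i : Fin d) : FieldDep 𝕜 U :=
  sA (W.br (pull f + PhiL L f) (Phi i))

/-- `s_A^*{π^*f, π^*g}_{ω⁻¹} - s_A^*{Φ_A(L_f), Φ_A(L_g)}_{ω⁻¹}`. -/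
def scaledBracket (W : SymplecticEmbedding Θ) (L : Fin d → Fin d → FieldDep 𝕜 U)
    (f g : FieldDep 𝕜 U) : FieldDep 𝕜 U :=
  sA (W.br (pull f) (pull g)) - sA (W.br (PhiL L f) (PhiL L g))

/-- The field dependent bracket `⟦f, g⟧`, given by `t ⟦f, g⟧ = scaledBracket f g`. -/
def gaugeBracket (W : SymplecticEmbedding Θ) (L : Fin d → Fin d → FieldDep 𝕜 U)
    (f g : FieldDep 𝕜 U) : FieldDep 𝕜 U :=
  divT (scaledBracket W L f g)

/-- The right-hand side of the recursion relation for the Lagrangian multipliers. -/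
def recursionRHS (W : SymplecticEmbedding Θ) (L : Fin d → Fin d → FieldDep 𝕜 U)
    (f g : FieldDep 𝕜 U) (i : Fin d) : FieldDep 𝕜 U :=
  vary (gaugeVariation W L f) (multiplier L g i)
    - vary (gaugeVariation W L g) (multiplier L f i)
    + sA (pDeriv i (W.br (pull f) (pull g)))
    + ∑ j, ∑ k, multiplier L f j * multiplier L g k * sA (pDeriv i (W.br (Phi j) (Phi k)))
    + sA (W.br (pull f) (pull (multiplier L g i)))
    - sA (W.br (pull g) (pull (multiplier L f i)))
    + sA (W.br (pull (multiplier L f i)) (PhiL L g))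
    - sA (W.br (pull (multiplier L g i)) (PhiL L f))
    + ∑ j, multiplier L g j * sA (pDeriv i (W.br (pull f) (Phi j)))
    - ∑ j, multiplier L f j * sA (pDeriv i (W.br (pull g) (Phi j)))

/-- The recursion relation: `L^i_{t⟦f,g⟧(A)}` equals `recursionRHS` for all gauge parameters
`f, g ∈ C^∞(U)` and all gauge fields `A ∈ Ω^1(U)`. -/
def SatisfiesRecursion (W : SymplecticEmbedding Θ) (L : Fin d → Fin d → FieldDep 𝕜 U) : Prop :=
  ∀ (f g : SmoothFn 𝕜 U) (A : Fin d → SmoothFn 𝕜 U) (i : Fin d),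
    evalAt A (multiplier L (PowerSeries.X * gaugeBracket W L (param f) (param g)) i) =
      evalAt A (recursionRHS W L (param f) (param g) i)

/-! ### Almost Poisson gauge transformations -/

/-- The operator `1 + δ` on functionals of the gauge field, for the variation `A ↦ A + Q`. -/
def onePlus (Q : Fin d → FieldDep 𝕜 U) (G : FieldDep 𝕜 U) : FieldDep 𝕜 U := G + vary Q G

/-- `(f, A) ↦ A + δ_f A` is an almost Poisson gauge transformation with field dependent
bracket `⟦·,·⟧`. -/
structure IsAlmostPoissonGauge (Θ : AlmostPoisson 𝕜 U)
    (δ : FieldDep 𝕜 U → Fin d → FieldDep 𝕜 U)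
    (brk : FieldDep 𝕜 U → FieldDep 𝕜 U → FieldDep 𝕜 U) : Prop where
  /-- `δ_f A` depends on the first jet of `A` -/
  variation_jet : ∀ (f : SmoothFn 𝕜 U) i, IsFirstOrder (δ (param f) i)
  variation_add : ∀ (f g : SmoothFn 𝕜 U) i,
    δ (param (f + g)) i = δ (param f) i + δ (param g) i
  variation_smul : ∀ (c : 𝕜) (f : SmoothFn 𝕜 U) i, δ (param (c • f)) i = c • δ (param f) i
  /-- at `t = 0` one has `δ_f A = df` -/
  variation_initial : ∀ (f : SmoothFn 𝕜 U) i,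
    PowerSeries.constantCoeff (δ (param f) i) = MvPolynomial.C (pd i f)
  variation_leibniz : ∀ (f g : SmoothFn 𝕜 U) i,
    δ (param (f * g)) i = param g * δ (param f) i + param f * δ (param g) i
  /-- `[1 + δ_f, 1 + δ_g] A = δ_{t⟦f,g⟧(A)} A` -/
  closure : ∀ (f g : SmoothFn 𝕜 U) (A : Fin d → SmoothFn 𝕜 U) i,
    evalAt A (onePlus (δ (param f)) (onePlus (δ (param g)) (gaugeField i))
        - onePlus (δ (param g)) (onePlus (δ (param f)) (gaugeField i))) =
      evalAt A (δ (PowerSeries.X * brk (param f) (param g)) i)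
  /-- `⟦f, g⟧ ∈ C^∞_pol(J^1 T^*U)[[t]]` -/
  bracket_jet : ∀ f g : SmoothFn 𝕜 U, IsFirstOrder (brk (param f) (param g))
  bracket_skew : ∀ f g : SmoothFn 𝕜 U, brk (param f) (param g) = -brk (param g) (param f)
  bracket_add : ∀ f g h : SmoothFn 𝕜 U,
    brk (param (f + g)) (param h) = brk (param f) (param h) + brk (param g) (param h)
  bracket_smul : ∀ (c : 𝕜) (f g : SmoothFn 𝕜 U),
    brk (param (c • f)) (param g) = c • brk (param f) (param g)
  /-- at `t = 0` one has `⟦f, g⟧ = {f, g}_θ` -/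
  bracket_initial : ∀ f g : SmoothFn 𝕜 U,
    PowerSeries.constantCoeff (brk (param f) (param g)) = MvPolynomial.C (Θ.bracket f g)
  /-- `Cyc_{f,g,h} (t ⟦h, ⟦f, g⟧(A)⟧(A) + δ_h ⟦f, g⟧(A)) = 0` -/
  bracket_jacobi : ∀ (f g h : SmoothFn 𝕜 U) (A : Fin d → SmoothFn 𝕜 U),
    evalAt A
      ((PowerSeries.X * brk (param h) (brk (param f) (param g))
          + vary (δ (param h)) (brk (param f) (param g)))
        + (PowerSeries.X * brk (param f) (brk (param g) (param h))
          + vary (δ (param f)) (brk (param g) (param h)))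
        + (PowerSeries.X * brk (param g) (brk (param h) (param f))
          + vary (δ (param g)) (brk (param h) (param f)))) = 0
  /-- `⟦f, ·⟧` is a `𝕜`-linear derivation on field dependent gauge parameters -/
  bracket_deriv_add : ∀ (f : SmoothFn 𝕜 U) (G H : FieldDep 𝕜 U),
    brk (param f) (G + H) = brk (param f) G + brk (param f) H
  bracket_deriv_smul : ∀ (c : 𝕜) (f : SmoothFn 𝕜 U) (G : FieldDep 𝕜 U),
    brk (param f) (c • G) = c • brk (param f) G
  bracket_deriv_mul : ∀ (f : SmoothFn 𝕜 U) (G H : FieldDep 𝕜 U),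
    brk (param f) (G * H) = H * brk (param f) G + G * brk (param f) H

end Core

end

end AlmostPoissonGauge

namespace AlmostPoissonGauge

noncomputable section

/-! ### Derivations of formal power series along a ring homomorphism -/

section Along

variable {A B C : Type} [CommRing A] [CommRing B] [CommRing C]

/-! Put `H_f = π^*f + Φ_A(L_f)` and let `E_f = δ_f + {H_f, ·}`, where `δ_f` varies the jets of `A`
and fixes `p`. Since `δ_f Φ_A = -δ_f A`, the definition of `δ_f A` says exactly that `E_f`
annihilates the constraints on the graph `p = A(x)`: `E_f` is tangent to the graph, so the
restriction of `E_f F` depends only on that of `F` (`sA_eq_of_tangent`).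

The form is closed and independent of `A`, so the Jacobi identity (`br_jacobi`) and `varyPhase_br`
give `[E_f, E_g] = [δ_f, δ_g] + {K, ·}` with curvature `K = δ_f H_g - δ_g H_f + {H_f, H_g}`. Applied
to `Φ_A` on the graph this yields `[δ_f, δ_g] A = s_A^*{K, Φ_A}` (`vary_commutator`). On the graph a
bracket with `K` sees only the restriction of `K`, which is `t⟦f,g⟧` (`sA_curvature`), and its fibre
derivatives, which are the right-hand side of the recursion (`sA_pDeriv_curvature`). The recursion
therefore says that `K` and `H_{t⟦f,g⟧}` agree to first order along the graph, and closure follows.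

For the Jacobi identity, restrict the Bianchi identity `Cyc E_h K_{f,g} = Cyc [δ_f, δ_g] H_h`
(`curvature_bianchi`). The left side produces the wanted terms minus `L_h^i δ_{t⟦f,g⟧} A_i`; the
right side is `-L_h^i [δ_f, δ_g] A_i`, which by closure is the same correction. One power of `t` is
then cancelled.

Identities between operators are proved by observing that both sides are `t`-linear derivations
along the same homomorphism and comparing them on coefficients and variables
(`IsDerivationAlong.ext_mvPolynomial`). They hold in the jet algebra; evaluation at a gauge field
enters only with the recursion, whose use is never followed by a further variation. -/

theorem powerSeries_map_X (φ : A →+* B) :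
    PowerSeries.map φ (PowerSeries.X : PowerSeries A) = PowerSeries.X :=
  PowerSeries.map_X φ

/-- Two additive `t`-linear maps of formal power series agree if they agree on constants. -/
theorem eq_of_eq_on_C {D D' : PowerSeries A → PowerSeries B}
    (hadd : ∀ F G, D (F + G) = D F + D G) (hX : ∀ F, D (PowerSeries.X * F) = PowerSeries.X * D F)
    (hadd' : ∀ F G, D' (F + G) = D' F + D' G)
    (hX' : ∀ F, D' (PowerSeries.X * F) = PowerSeries.X * D' F)
    (h : ∀ a, D (PowerSeries.C a) = D' (PowerSeries.C a)) (F : PowerSeries A) : D F = D' F := by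
  ext n
  induction n generalizing F with
  | zero =>
    rw [PowerSeries.eq_X_mul_shift_add_const F, hadd, hadd', hX, hX', h]
    simp
  | succ n ih =>
    rw [PowerSeries.eq_X_mul_shift_add_const F, hadd, hadd', hX, hX', h, map_add, map_add,
      PowerSeries.coeff_succ_X_mul, PowerSeries.coeff_succ_X_mul, ih]

/-- `D` is a `t`-linear derivation of formal power series along the `t`-linear ring homomorphism
`φ`. -/
structure IsDerivationAlong (φ : PowerSeries A →+* PowerSeries B)
    (D : PowerSeries A → PowerSeries B) : Prop where
  hom_X : φ PowerSeries.X = PowerSeries.X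
  add : ∀ F G, D (F + G) = D F + D G
  mul : ∀ F G, D (F * G) = φ F * D G + φ G * D F
  X_mul : ∀ F, D (PowerSeries.X * F) = PowerSeries.X * D F

namespace IsDerivationAlong

variable {φ : PowerSeries A →+* PowerSeries B} {D D' : PowerSeries A → PowerSeries B}

theorem zero (h : IsDerivationAlong φ D) : D 0 = 0 := by
  have := h.add 0 0
  simpa using this

theorem neg (h : IsDerivationAlong φ D) (F : PowerSeries A) : D (-F) = -D F := by
  have := h.add F (-F)
  rw [add_neg_cancel, h.zero] at this
  exact (neg_eq_of_add_eq_zero_right this.symm).symm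

theorem sub (h : IsDerivationAlong φ D) (F G : PowerSeries A) : D (F - G) = D F - D G := by
  rw [sub_eq_add_neg, h.add, h.neg, sub_eq_add_neg]

theorem sum (h : IsDerivationAlong φ D) {ι : Type} (s : Finset ι) (F : ι → PowerSeries A) :
    D (∑ i ∈ s, F i) = ∑ i ∈ s, D (F i) := by
  classical
  induction s using Finset.induction_on with
  | empty => simpa using h.zero
  | insert a s ha ih => rw [Finset.sum_insert ha, Finset.sum_insert ha, h.add, ih]

/-- A `t`-linear additive map satisfying the Leibniz rule on constants is a derivation. -/
theorem of_constants (hφ : φ PowerSeries.X = PowerSeries.X)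
    (hadd : ∀ F G, D (F + G) = D F + D G)
    (hX : ∀ F, D (PowerSeries.X * F) = PowerSeries.X * D F)
    (hmul : ∀ a b, D (PowerSeries.C (a * b)) =
      φ (PowerSeries.C a) * D (PowerSeries.C b) + φ (PowerSeries.C b) * D (PowerSeries.C a)) :
    IsDerivationAlong φ D := by
  refine ⟨hφ, hadd, fun F G => ?_, hX⟩
  refine eq_of_eq_on_C (D := fun F => D (F * G)) (D' := fun F => φ F * D G + φ G * D F)
    ?_ ?_ ?_ ?_ ?_ F
  · intro F F'; simp only [add_mul, hadd]
  · intro F; simp only [mul_assoc, hX]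
  · intro F F'; simp only [map_add, hadd]; ring
  · intro F; simp only [map_mul, hφ, hX]; ring
  intro a
  refine eq_of_eq_on_C (D := fun G => D (PowerSeries.C a * G))
    (D' := fun G => φ (PowerSeries.C a) * D G + φ G * D (PowerSeries.C a)) ?_ ?_ ?_ ?_ ?_ G
  · intro F F'; simp only [mul_add, hadd]
  · intro F; simp only [mul_left_comm _ PowerSeries.X, hX]
  · intro F F'; simp only [map_add, hadd]; ring
  · intro F; simp only [map_mul, hφ, hX]; ring
  intro b
  simp only [← map_mul, hmul]

theorem comp_hom {ψ : PowerSeries B →+* PowerSeries C} {E : PowerSeries B → PowerSeries C}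
    (hE : IsDerivationAlong ψ E) {χ : PowerSeries A →+* PowerSeries B}
    (hχ : χ PowerSeries.X = PowerSeries.X) :
    IsDerivationAlong (ψ.comp χ) (fun F => E (χ F)) where
  hom_X := by simp [hχ, hE.hom_X]
  add F G := by simp [hE.add]
  mul F G := by simp [hE.mul]
  X_mul F := by simp [hχ, hE.X_mul]

theorem hom_comp (h : IsDerivationAlong φ D) {χ : PowerSeries B →+* PowerSeries C}
    (hχ : χ PowerSeries.X = PowerSeries.X) :
    IsDerivationAlong (χ.comp φ) (fun F => χ (D F)) where
  hom_X := by simp [hχ, h.hom_X]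
  add F G := by simp [h.add]
  mul F G := by simp [h.mul]
  X_mul F := by simp [h.X_mul, hχ]

theorem add_map (h : IsDerivationAlong φ D) (h' : IsDerivationAlong φ D') :
    IsDerivationAlong φ (fun F => D F + D' F) where
  hom_X := h.hom_X
  add F G := by simp only [h.add, h'.add]; ring
  mul F G := by simp only [h.mul, h'.mul]; ring
  X_mul F := by simp only [h.X_mul, h'.X_mul]; ring

theorem mul_left (h : IsDerivationAlong φ D) (b : PowerSeries B) :
    IsDerivationAlong φ (fun F => b * D F) where
  hom_X := h.hom_X
  add F G := by simp only [h.add]; ring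
  mul F G := by simp only [h.mul]; ring
  X_mul F := by simp only [h.X_mul]; ring

theorem zero_map (hφ : φ PowerSeries.X = PowerSeries.X) :
    IsDerivationAlong φ (fun _ => 0) := by
  constructor <;> simp [hφ]

theorem sum_map (hφ : φ PowerSeries.X = PowerSeries.X) {ι : Type} (s : Finset ι)
    {E : ι → PowerSeries A → PowerSeries B} (h : ∀ i, IsDerivationAlong φ (E i)) :
    IsDerivationAlong φ (fun F => ∑ i ∈ s, E i F) where
  hom_X := hφ
  add F G := by simp only [(h _).add, Finset.sum_add_distrib]
  mul F G := by simp only [(h _).mul, Finset.sum_add_distrib, Finset.mul_sum]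
  X_mul F := by simp only [(h _).X_mul, Finset.mul_sum]

/-- The mixed products are symmetric in the two derivations and cancel. This allows commutation of
two derivations to be tested on generators. -/
theorem commutator {E E' : PowerSeries A → PowerSeries A}
    (h : IsDerivationAlong (RingHom.id _) E) (h' : IsDerivationAlong (RingHom.id _) E') :
    IsDerivationAlong (RingHom.id _) (fun F => E (E' F) - E' (E F)) where
  hom_X := rfl
  add F G := by simp only [h.add, h'.add]; ring
  mul F G := by simp only [h.add, h'.add, h.mul, h'.mul, RingHom.id_apply]; ring
  X_mul F := by simp only [h.X_mul, h'.X_mul]; ring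

end IsDerivationAlong

theorem mapT_C {D : A → B} (h0 : D 0 = 0) (a : A) :
    mapT D (PowerSeries.C a) = PowerSeries.C (D a) := by
  ext n
  rw [mapT, PowerSeries.coeff_mk, PowerSeries.coeff_C, PowerSeries.coeff_C]
  split_ifs <;> simp [h0]

theorem isDerivationAlong_mapT {D : A → A} (hadd : ∀ a b, D (a + b) = D a + D b)
    (hmul : ∀ a b, D (a * b) = a * D b + b * D a) :
    IsDerivationAlong (RingHom.id _) (mapT D) := by
  have h0 : D 0 = 0 := by simpa using hadd 0 0
  refine .of_constants rfl ?_ ?_ ?_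
  · intro F G
    ext n
    simp [mapT, hadd]
  · intro F
    ext (_ | n)
    · simp [mapT, h0]
    · simp [mapT, PowerSeries.coeff_succ_X_mul]
  · intro a b
    rw [mapT_C h0, mapT_C h0, mapT_C h0, hmul, map_add, map_mul, map_mul]
    rfl

/-! ### Derivations of power series over polynomial rings -/

section MvPolynomial

variable {σ S : Type} [CommRing S] {φ : PowerSeries (MvPolynomial σ S) →+* PowerSeries B}
  {D D' : PowerSeries (MvPolynomial σ S) → PowerSeries B}

/-- Derivations along `φ` are determined by their values on coefficients and variables. -/
theorem IsDerivationAlong.ext_mvPolynomial (h : IsDerivationAlong φ D)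
    (h' : IsDerivationAlong φ D')
    (hC : ∀ a, D (PowerSeries.C (MvPolynomial.C a)) = D' (PowerSeries.C (MvPolynomial.C a)))
    (hv : ∀ v, D (PowerSeries.C (MvPolynomial.X v)) = D' (PowerSeries.C (MvPolynomial.X v)))
    (F : PowerSeries (MvPolynomial σ S)) : D F = D' F := by
  refine eq_of_eq_on_C h.add h.X_mul h'.add h'.X_mul (fun P => ?_) F
  induction P using MvPolynomial.induction_on with
  | C a => exact hC a
  | add p q hp hq => rw [map_add, h.add, h'.add, hp, hq]
  | mul_X p v hp => rw [map_mul, h.mul, h'.mul, hp, hv]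

/-- The `t`-linear derivation of `S[X_v | v ∈ σ][[t]]` which kills `S` and sends `X_v` to
`s v`. -/
def varyBy (s : σ → PowerSeries (MvPolynomial σ S)) (G : PowerSeries (MvPolynomial σ S)) :
    PowerSeries (MvPolynomial σ S) :=
  PowerSeries.mk fun n => ∑ m ∈ Finset.HasAntidiagonal.antidiagonal n,
    PowerSeries.coeff m.2 (MvPolynomial.mkDerivation S s (PowerSeries.coeff m.1 G))

theorem varyBy_C (s : σ → PowerSeries (MvPolynomial σ S)) (P : MvPolynomial σ S) :
    varyBy s (PowerSeries.C P) = MvPolynomial.mkDerivation S s P := by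
  ext n : 1
  rw [varyBy, PowerSeries.coeff_mk, Finset.sum_eq_single (0, n)]
  · simp
  · rintro ⟨i, j⟩ hij hne
    have hi : i ≠ 0 := by
      rintro rfl
      exact hne (by simpa using hij)
    simp [PowerSeries.coeff_C, hi]
  · simp

/-- The values `s v` are themselves power series, so the coefficients are convolved; this
convolution is what makes the map `t`-linear. -/
theorem isDerivationAlong_varyBy (s : σ → PowerSeries (MvPolynomial σ S)) :
    IsDerivationAlong (RingHom.id _) (varyBy s) := by
  refine .of_constants rfl ?_ ?_ ?_
  · intro F G
    ext n : 1
    simp [varyBy, Finset.sum_add_distrib]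
  · intro F
    ext (_ | n) : 1
    · simp [varyBy]
    -- The split-off pair `(0, n + 1)` contributes nothing because `X * F` has no constant term.
    · rw [varyBy, PowerSeries.coeff_mk, Finset.Nat.sum_antidiagonal_succ,
        PowerSeries.coeff_succ_X_mul, varyBy, PowerSeries.coeff_mk]
      simp [PowerSeries.coeff_succ_X_mul]
  · intro a b
    simp only [varyBy_C, Derivation.leibniz, PowerSeries.smul_eq_C_mul, RingHom.id_apply]

theorem varyBy_C_C (s : σ → PowerSeries (MvPolynomial σ S)) (a : S) :
    varyBy s (PowerSeries.C (MvPolynomial.C a)) = 0 := by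
  rw [varyBy_C, MvPolynomial.derivation_C]

theorem varyBy_C_X (s : σ → PowerSeries (MvPolynomial σ S)) (v : σ) :
    varyBy s (PowerSeries.C (MvPolynomial.X v)) = s v := by
  rw [varyBy_C, MvPolynomial.mkDerivation_X]

end MvPolynomial

end Along

/-! ### Total derivatives -/

section Total

variable {𝕜 : Type} [RCLike 𝕜] {d : ℕ} {U : Opens (EuclideanSpace ℝ (Fin d))}

theorem pd_comm (i j : Fin d) (f : SmoothFn 𝕜 U) : pd i (pd j f) = pd j (pd i f) := by
  have key : ∀ (i j : Fin d) (x : U), (pd i (pd j f)).1 x =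
      fderiv ℝ (fderiv ℝ (extendZero f.1)) (x : EuclideanSpace ℝ (Fin d))
        (EuclideanSpace.single i 1) (EuclideanSpace.single j 1) := by
    intro i j x
    change fderiv ℝ (extendZero (pd j f).1) (x : EuclideanSpace ℝ (Fin d)) _ = _
    -- The extension by zero is the true derivative only on `U`; openness of `U` makes this enough
    -- for differentiating again at `x`.
    have he : extendZero (pd j f).1 =ᶠ[nhds (x : EuclideanSpace ℝ (Fin d))]
        fun y => fderiv ℝ (extendZero f.1) y (EuclideanSpace.single j 1) :=
      extendZero_eventuallyEq x fun y => rfl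
    refine (congrArg (fun T : EuclideanSpace ℝ (Fin d) →L[ℝ] 𝕜 => T (EuclideanSpace.single i 1)) he.fderiv_eq).trans ?_
    have hd : DifferentiableAt ℝ (fderiv ℝ (extendZero f.1)) (x : EuclideanSpace ℝ (Fin d)) :=
      ((contDiffAt_extendZero f x).fderiv_right (m := ∞) (by simp)).differentiableAt (by simp)
    rw [fderiv_clm_apply hd (differentiableAt_const _)]
    simp
  refine Subtype.ext (funext fun x => ?_)
  rw [key, key]
  refine ((contDiffAt_extendZero f x).isSymmSndFDerivAt ?_).eq _ _
  simpa using WithTop.coe_le_coe.2 (le_top (a := (2 : ℕ∞)))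

theorem pd_add (i : Fin d) (f g : SmoothFn 𝕜 U) : pd i (f + g) = pd i f + pd i g :=
  map_add (pdDer (𝕜 := 𝕜) (U := U) i) f g

theorem pd_mul (i : Fin d) (f g : SmoothFn 𝕜 U) : pd i (f * g) = f * pd i g + g * pd i f :=
  (pdDer (𝕜 := 𝕜) (U := U) i).leibniz f g

theorem pd_zero (i : Fin d) : pd i (0 : SmoothFn 𝕜 U) = 0 :=
  map_zero (pdDer (𝕜 := 𝕜) (U := U) i)

theorem pd_one (i : Fin d) : pd i (1 : SmoothFn 𝕜 U) = 0 :=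
  (pdDer (𝕜 := 𝕜) (U := U) i).map_one_eq_zero

/-! ### Coefficientwise derivatives of polynomials -/

variable {σ : Type}

/-- Outside the support both sides are derivatives of zero. Sums and products can then be compared
coefficient by coefficient without tracking supports. -/
theorem coeff_sum_monomial_pd (i : Fin d) (P : MvPolynomial σ (SmoothFn 𝕜 U)) (m : σ →₀ ℕ) :
    MvPolynomial.coeff m
      (∑ n ∈ P.support, MvPolynomial.monomial n (pd i (MvPolynomial.coeff n P))) =
      pd i (MvPolynomial.coeff m P) := by
  classical
  rw [MvPolynomial.coeff_sum]
  simp only [MvPolynomial.coeff_monomial]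
  rw [Finset.sum_ite_eq']
  split_ifs with h
  · rfl
  · rw [MvPolynomial.notMem_support_iff.1 h, pd_zero]

theorem extendD_add (i : Fin d) (s : σ → MvPolynomial σ (SmoothFn 𝕜 U))
    (P Q : MvPolynomial σ (SmoothFn 𝕜 U)) :
    extendD i s (P + Q) = extendD i s P + extendD i s Q := by
  have : ∑ n ∈ (P + Q).support, MvPolynomial.monomial n (pd i (MvPolynomial.coeff n (P + Q))) =
      ∑ n ∈ P.support, MvPolynomial.monomial n (pd i (MvPolynomial.coeff n P)) +
      ∑ n ∈ Q.support, MvPolynomial.monomial n (pd i (MvPolynomial.coeff n Q)) := by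
    ext m : 1
    rw [MvPolynomial.coeff_add, coeff_sum_monomial_pd, coeff_sum_monomial_pd,
      coeff_sum_monomial_pd, MvPolynomial.coeff_add, pd_add]
  rw [extendD, this, map_add, extendD, extendD]
  ring

theorem extendD_mul (i : Fin d) (s : σ → MvPolynomial σ (SmoothFn 𝕜 U))
    (P Q : MvPolynomial σ (SmoothFn 𝕜 U)) :
    extendD i s (P * Q) = P * extendD i s Q + Q * extendD i s P := by
  have : ∑ n ∈ (P * Q).support, MvPolynomial.monomial n (pd i (MvPolynomial.coeff n (P * Q))) =
      P * ∑ n ∈ Q.support, MvPolynomial.monomial n (pd i (MvPolynomial.coeff n Q)) +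
      Q * ∑ n ∈ P.support, MvPolynomial.monomial n (pd i (MvPolynomial.coeff n P)) := by
    classical
    ext m : 1
    rw [MvPolynomial.coeff_add, mul_comm Q, coeff_sum_monomial_pd, MvPolynomial.coeff_mul,
      MvPolynomial.coeff_mul, MvPolynomial.coeff_mul]
    simp only [coeff_sum_monomial_pd]
    have hs : ∀ (s : Finset ((σ →₀ ℕ) × (σ →₀ ℕ)))
        (F : (σ →₀ ℕ) × (σ →₀ ℕ) → SmoothFn 𝕜 U), pd i (∑ x ∈ s, F x) = ∑ x ∈ s, pd i (F x) :=
      fun s F => map_sum (pdDer (𝕜 := 𝕜) (U := U) i) F s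
    rw [hs, ← Finset.sum_add_distrib]
    refine Finset.sum_congr rfl fun x _ => ?_
    rw [pd_mul]
    ring
  rw [extendD, this, Derivation.leibniz, extendD, extendD, smul_eq_mul, smul_eq_mul]
  ring

theorem extendD_zero (i : Fin d) (s : σ → MvPolynomial σ (SmoothFn 𝕜 U)) :
    extendD i s 0 = 0 := by
  simp [extendD]

theorem extendD_C (i : Fin d) (s : σ → MvPolynomial σ (SmoothFn 𝕜 U)) (a : SmoothFn 𝕜 U) :
    extendD i s (MvPolynomial.C a) = MvPolynomial.C (pd i a) := by
  classical
  rw [extendD, MvPolynomial.derivation_C, add_zero]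
  ext m : 1
  rw [coeff_sum_monomial_pd, MvPolynomial.coeff_C, MvPolynomial.coeff_C]
  split_ifs
  · rfl
  · exact pd_zero i

theorem extendD_X (i : Fin d) (s : σ → MvPolynomial σ (SmoothFn 𝕜 U)) (v : σ) :
    extendD i s (MvPolynomial.X v) = s v := by
  classical
  rw [extendD, MvPolynomial.mkDerivation_X, add_eq_right]
  ext m : 1
  rw [coeff_sum_monomial_pd, MvPolynomial.coeff_X, MvPolynomial.coeff_zero]
  split_ifs
  · exact pd_one i
  · exact pd_zero i

theorem isDerivationAlong_mapT_extendD (i : Fin d) (s : σ → MvPolynomial σ (SmoothFn 𝕜 U)) :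
    IsDerivationAlong (RingHom.id _) (mapT (extendD i s)) :=
  isDerivationAlong_mapT (extendD_add i s) (extendD_mul i s)

theorem isDerivationAlong_mapT_pderiv {S : Type} [CommRing S] (v : σ) :
    IsDerivationAlong (RingHom.id _) (mapT (MvPolynomial.pderiv (R := S) v)) :=
  isDerivationAlong_mapT (fun a b => map_add _ a b) (fun a b => by
    rw [Derivation.leibniz, smul_eq_mul, smul_eq_mul])

/-! #### Values on generators -/

theorem isDerivationAlong_phaseD (a : Fin d ⊕ Fin d) :
    IsDerivationAlong (RingHom.id _) (phaseD (𝕜 := 𝕜) (U := U) a) := by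
  rcases a with i | i
  · exact isDerivationAlong_mapT_extendD i _
  · exact isDerivationAlong_mapT_pderiv i

theorem isDerivationAlong_jetPhaseD (a : Fin d ⊕ Fin d) :
    IsDerivationAlong (RingHom.id _) (jetPhaseD (𝕜 := 𝕜) (U := U) a) := by
  rcases a with i | i
  · exact isDerivationAlong_mapT_extendD i _
  · exact isDerivationAlong_mapT_pderiv (Sum.inl i)

theorem isDerivationAlong_totalD (i : Fin d) :
    IsDerivationAlong (RingHom.id _) (totalD (𝕜 := 𝕜) (U := U) i) :=
  isDerivationAlong_mapT_extendD i _

theorem phaseD_coeff (a : Fin d ⊕ Fin d) (f : SmoothFn 𝕜 U) :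
    phaseD a (PowerSeries.C (MvPolynomial.C f)) =
      Sum.elim (fun i => PowerSeries.C (MvPolynomial.C (pd i f))) (fun _ => 0) a := by
  rcases a with i | i
  · simp only [phaseD, Sum.elim_inl]
    rw [mapT_C (extendD_zero _ _), extendD_C]
  · simp only [phaseD, Sum.elim_inr]
    rw [mapT_C (map_zero _), MvPolynomial.pderiv_C, map_zero]

theorem phaseD_momentum (a : Fin d ⊕ Fin d) (j : Fin d) :
    phaseD (𝕜 := 𝕜) (U := U) a (PowerSeries.C (MvPolynomial.X j)) =
      Sum.elim (fun _ => 0) (fun i => if i = j then 1 else 0) a := by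
  classical
  rcases a with i | i
  · simp only [phaseD, Sum.elim_inl]
    rw [mapT_C (extendD_zero _ _), extendD_X, Pi.zero_apply, map_zero]
  · simp only [phaseD, Sum.elim_inr]
    rw [mapT_C (map_zero _), MvPolynomial.pderiv_X, Pi.single_apply]
    simp only [eq_comm (a := j)]
    split_ifs <;> simp

theorem jetPhaseD_coeff (a : Fin d ⊕ Fin d) (f : SmoothFn 𝕜 U) :
    jetPhaseD a (PowerSeries.C (MvPolynomial.C f)) =
      Sum.elim (fun i => PowerSeries.C (MvPolynomial.C (pd i f))) (fun _ => 0) a := by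
  rcases a with i | i
  · simp only [jetPhaseD, Sum.elim_inl]
    rw [mapT_C (extendD_zero _ _), extendD_C]
  · simp only [jetPhaseD, Sum.elim_inr]
    rw [mapT_C (map_zero _), MvPolynomial.pderiv_C, map_zero]

theorem jetPhaseD_momentum (a : Fin d ⊕ Fin d) (j : Fin d) :
    jetPhaseD (𝕜 := 𝕜) (U := U) a (PowerSeries.C (MvPolynomial.X (Sum.inl j))) =
      Sum.elim (fun _ => 0) (fun i => if i = j then 1 else 0) a := by
  classical
  rcases a with i | i
  · simp only [jetPhaseD, Sum.elim_inl]
    rw [mapT_C (extendD_zero _ _), extendD_X, Sum.elim_inl, Pi.zero_apply, map_zero]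
  · simp only [jetPhaseD, Sum.elim_inr]
    rw [mapT_C (map_zero _), MvPolynomial.pderiv_X, Pi.single_apply]
    simp only [Sum.inl.injEq, eq_comm (a := j)]
    split_ifs <;> simp

theorem jetPhaseD_jet (a : Fin d ⊕ Fin d) (v : JetIdx d) :
    jetPhaseD (𝕜 := 𝕜) (U := U) a (PowerSeries.C (MvPolynomial.X (Sum.inr v))) =
      Sum.elim (fun i => PowerSeries.C (MvPolynomial.X (Sum.inr (v.1, v.2 + Finsupp.single i 1))))
        (fun _ => 0) a := by
  classical
  rcases a with i | i
  · simp only [jetPhaseD, Sum.elim_inl]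
    rw [mapT_C (extendD_zero _ _), extendD_X, Sum.elim_inr]
  · simp only [jetPhaseD, Sum.elim_inr]
    rw [mapT_C (map_zero _), MvPolynomial.pderiv_X_of_ne (by simp), map_zero]

theorem totalD_param (i : Fin d) (f : SmoothFn 𝕜 U) : totalD i (param f) = param (pd i f) := by
  rw [totalD, param, mapT_C (extendD_zero _ _), extendD_C, param]

theorem totalD_jet (i : Fin d) (v : JetIdx d) :
    totalD (𝕜 := 𝕜) (U := U) i (PowerSeries.C (MvPolynomial.X v)) =
      PowerSeries.C (MvPolynomial.X (v.1, v.2 + Finsupp.single i 1)) := by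
  rw [totalD, mapT_C (extendD_zero _ _), extendD_X]

/-! ### Commuting derivatives and multi-indices -/

theorem jetPhaseD_comm (a b : Fin d ⊕ Fin d) (F : PowerSeries (JetPhase 𝕜 U)) :
    jetPhaseD a (jetPhaseD b F) = jetPhaseD b (jetPhaseD a F) := by
  have ha := isDerivationAlong_jetPhaseD (𝕜 := 𝕜) (U := U) a
  have hb := isDerivationAlong_jetPhaseD (𝕜 := 𝕜) (U := U) b
  -- Derivatives of momenta are Kronecker deltas, which every derivation kills.
  have h01 : ∀ (c : Fin d ⊕ Fin d) (p : Prop) [Decidable p],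
      jetPhaseD (𝕜 := 𝕜) (U := U) c (if p then 1 else 0) = 0 := by
    intro c p _
    have h := isDerivationAlong_jetPhaseD (𝕜 := 𝕜) (U := U) c
    split_ifs
    · have := h.mul 1 1
      simpa using this
    · exact h.zero
  rw [← sub_eq_zero]
  refine (ha.commutator hb).ext_mvPolynomial (.zero_map rfl) (fun f => ?_) (fun v => ?_) F
  · rw [sub_eq_zero, jetPhaseD_coeff, jetPhaseD_coeff]
    rcases a with i | i <;> rcases b with j | j <;>
      simp [ha.zero, hb.zero, jetPhaseD_coeff, pd_comm i j]
  · rw [sub_eq_zero]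
    rcases v with j | v
    · rw [jetPhaseD_momentum, jetPhaseD_momentum]
      rcases a with i | i <;> rcases b with k | k <;> simp [ha.zero, hb.zero, h01]
    · rw [jetPhaseD_jet, jetPhaseD_jet]
      rcases a with i | i <;> rcases b with k | k <;>
        simp [ha.zero, hb.zero, jetPhaseD_jet, add_right_comm]

theorem totalD_comm (i j : Fin d) (F : FieldDep 𝕜 U) :
    totalD i (totalD j F) = totalD j (totalD i F) := by
  rw [← sub_eq_zero]
  refine ((isDerivationAlong_totalD i).commutator (isDerivationAlong_totalD j)).ext_mvPolynomial
    (.zero_map rfl) (fun f => ?_) (fun v => ?_) F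
  · have h := totalD_param (𝕜 := 𝕜) (U := U)
    simp only [param] at h
    simp only [h, pd_comm i j, sub_self]
  · simp only [totalD_jet, add_right_comm, sub_self]

theorem foldr_add_single_of_notMem {B : Type} (D : Fin d → B → B) (α : Fin d →₀ ℕ) (i : Fin d)
    (b : B) (l : List (Fin d)) (hl : i ∉ l) :
    l.foldr (fun j c => (D j)^[(α + Finsupp.single i 1 : Fin d →₀ ℕ) j] c) b =
      l.foldr (fun j c => (D j)^[α j] c) b := by
  induction l with
  | nil => rfl
  | cons k l ih =>
    rw [List.mem_cons, not_or] at hl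
    simp only [List.foldr_cons]
    rw [ih hl.2]
    simp [hl.1]

/-- `iterD` composes in a fixed order, so the extra `D i` must be moved outward past the operators
preceding it in the list; commutativity is needed exactly there. -/
theorem iterD_add_single {B : Type} (D : Fin d → B → B)
    (hD : ∀ i j b, D i (D j b) = D j (D i b)) (α : Fin d →₀ ℕ) (i : Fin d) (b : B) :
    iterD D (α + Finsupp.single i 1) b = D i (iterD D α b) := by
  have key : ∀ l : List (Fin d), l.Nodup → i ∈ l →
      l.foldr (fun j c => (D j)^[(α + Finsupp.single i 1 : Fin d →₀ ℕ) j] c) b =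
        D i (l.foldr (fun j c => (D j)^[α j] c) b) := by
    intro l
    induction l with
    | nil => intro _ h; exact absurd h List.not_mem_nil
    | cons k l ih =>
      intro hn hm
      rw [List.nodup_cons] at hn
      simp only [List.foldr_cons]
      rcases List.mem_cons.1 hm with rfl | hm
      · rw [foldr_add_single_of_notMem D α i b l hn.1, Finsupp.add_apply, Finsupp.single_eq_same,
          Function.iterate_succ_apply']
      · have hki : k ≠ i := fun h => hn.1 (h ▸ hm)
        rw [ih hn.2 hm, Finsupp.add_apply, Finsupp.single_eq_of_ne hki, add_zero]
        exact ((Function.Commute.iterate_right (f := D i) (g := D k)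
          (fun c => hD i k c) (α k)) _).symm
  exact key _ (List.nodup_finRange d) (List.mem_finRange i)

theorem iterD_zero {B : Type} (D : Fin d → B → B) (b : B) : iterD D 0 b = b := by
  rw [iterD]
  induction List.finRange d with
  | nil => rfl
  | cons k l ih => exact ih

end Total

/-! ### Jacobi identity for the bracket of a closed form -/

section AbstractJacobi

variable {R ι : Type} [CommRing R] [Fintype ι]

/-- An additive map satisfying the Leibniz rule, as a derivation. -/
def derivationOfLeibniz {T : Type} [CommRing T] (E : T → T) (hadd : ∀ F G, E (F + G) = E F + E G)
    (hmul : ∀ F G, E (F * G) = F * E G + G * E F) : Derivation ℤ T T :=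
  Derivation.mk' (AddMonoidHom.toIntLinearMap (AddMonoidHom.mk' E hadd)) hmul

/-- Bilinear bookkeeping for `sA_br_eq`, where `x` is a gradient on the graph and the correction
consists of gradients of the constraints. -/
theorem sum_bilinear_eq {T κ : Type} [CommRing T] [Fintype κ] (w : ι → ι → T) (x x₀ y : ι → T)
    (c : κ → T) (z : κ → ι → T) (hx : ∀ a, x a = x₀ a + ∑ j, z j a * c j) :
    ∑ a, ∑ b, w a b * x a * y b =
      ∑ a, ∑ b, w a b * x₀ a * y b + ∑ j, c j * ∑ a, ∑ b, w a b * z j a * y b := by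
  simp only [Finset.mul_sum]
  rw [Finset.sum_comm (γ := κ), ← Finset.sum_add_distrib]
  refine Finset.sum_congr rfl fun a _ => ?_
  rw [Finset.sum_comm (γ := κ), ← Finset.sum_add_distrib]
  refine Finset.sum_congr rfl fun b _ => ?_
  rw [hx a, mul_add, add_mul, Finset.mul_sum, Finset.sum_mul]
  congr 1
  exact Finset.sum_congr rfl fun j _ => by ring

/-- The Poisson bracket of the bivector `P`, with respect to given partial derivatives. -/
def bivectorBracket (D : ι → Derivation ℤ R R) (P : Matrix ι ι R) (F G : R) : R :=
  ∑ a, ∑ b, P a b * D a F * D b G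

/-- The components of the Hamiltonian vector field of `F`. -/
def hamiltonian (D : ι → Derivation ℤ R R) (P : Matrix ι ι R) (F : R) (b : ι) : R :=
  ∑ a, P a b * D a F

variable {D : ι → Derivation ℤ R R} {P Ω : Matrix ι ι R}

theorem bivectorBracket_eq_hamiltonian (F G : R) :
    bivectorBracket D P F G = ∑ b, hamiltonian D P F b * D b G := by
  rw [bivectorBracket, Finset.sum_comm]
  simp only [hamiltonian, Finset.sum_mul]

theorem hamiltonian_skew (hP : ∀ a b, P a b = -P b a) (F : R) (b : ι) :
    ∑ a, P b a * D a F = -hamiltonian D P F b := by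
  rw [hamiltonian, ← Finset.sum_neg_distrib]
  exact Finset.sum_congr rfl fun a _ => by rw [hP b a]; ring

variable [DecidableEq ι]

/-- Differentiate `P * Ω = 1` and multiply by `P` on the right. Derivatives of the bivector become
derivatives of the form, to which closedness applies. -/
theorem derivation_inverse (hl : P * Ω = 1) (a b c : ι) :
    D a (P b c) = -∑ m, ∑ n, P b m * D a (Ω m n) * P n c := by
  have hr : Ω * P = 1 := mul_eq_one_comm.1 hl
  have hmap : ∀ M N : Matrix ι ι R, (M * N).map (D a) = M * N.map (D a) + M.map (D a) * N := by
    intro M N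
    ext i j
    simp only [Matrix.map_apply, Matrix.mul_apply, Matrix.add_apply, map_sum, Derivation.leibniz,
      smul_eq_mul, Finset.sum_add_distrib]
    congr 1
    exact Finset.sum_congr rfl fun _ _ => mul_comm _ _
  have h1 : (1 : Matrix ι ι R).map (D a) = 0 := by
    ext i j
    rw [Matrix.map_apply, Matrix.one_apply]
    split_ifs <;> simp
  have h2 : P.map (D a) = -(P * Ω.map (D a) * P) := by
    have h3 := hmap P Ω
    rw [hl, h1] at h3
    have h4 : P.map (D a) * Ω = -(P * Ω.map (D a)) := by
      rw [eq_neg_iff_add_eq_zero, add_comm]; exact h3.symm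
    calc P.map (D a) = P.map (D a) * (Ω * P) := by rw [hr, mul_one]
      _ = -(P * Ω.map (D a) * P) := by rw [← mul_assoc, h4, neg_mul]
  have h5 := congrFun (congrFun h2 b) c
  rw [Matrix.map_apply] at h5
  rw [h5, Matrix.neg_apply, Matrix.mul_apply, Finset.sum_comm]
  simp only [Matrix.mul_apply, Matrix.map_apply, Finset.sum_mul]

/-- Isolates the two mechanisms of the Jacobi identity: the cubic term sums cyclically to `dΩ` on
three Hamiltonian vector fields, and the Hessian terms cancel in pairs. -/
theorem bivectorBracket_nested (hP : ∀ a b, P a b = -P b a) (hl : P * Ω = 1) (F G H : R) :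
    bivectorBracket D P F (bivectorBracket D P G H) =
      (∑ l, ∑ m, ∑ n, hamiltonian D P F l * hamiltonian D P G m * hamiltonian D P H n *
          D l (Ω m n))
        - (∑ l, ∑ m, hamiltonian D P F l * hamiltonian D P H m * D l (D m G))
        + ∑ l, ∑ m, hamiltonian D P F l * hamiltonian D P G m * D l (D m H) := by
  have key : ∀ l, D l (bivectorBracket D P G H) =
      (∑ m, ∑ n, hamiltonian D P G m * hamiltonian D P H n * D l (Ω m n))
        - (∑ m, hamiltonian D P H m * D l (D m G))
        + ∑ m, hamiltonian D P G m * D l (D m H) := by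
    intro l
    have e1 : D l (bivectorBracket D P G H) =
        (∑ b, ∑ c, D l (P b c) * D b G * D c H) + (∑ b, D l (D b G) * ∑ c, P b c * D c H)
          + ∑ c, hamiltonian D P G c * D l (D c H) := by
      have e2 : ∑ c, hamiltonian D P G c * D l (D c H) =
          ∑ b, ∑ c, P b c * D b G * D l (D c H) := by
        rw [Finset.sum_comm]
        simp only [hamiltonian, Finset.sum_mul]
      rw [e2, bivectorBracket]
      simp only [map_sum, Derivation.leibniz, smul_eq_mul, Finset.mul_sum,
        ← Finset.sum_add_distrib]
      refine Finset.sum_congr rfl fun b _ => Finset.sum_congr rfl fun c _ => ?_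
      ring
    -- The sign from `derivation_inverse` cancels the one from contracting `P` with `D c H` in its
    -- second index.
    have e3 : ∑ b, ∑ c, D l (P b c) * D b G * D c H =
        ∑ m, ∑ n, hamiltonian D P G m * hamiltonian D P H n * D l (Ω m n) := by
      calc ∑ b, ∑ c, D l (P b c) * D b G * D c H
          = ∑ b, ∑ c, ∑ m, ∑ n, -(P b m * D b G) * D l (Ω m n) * (P n c * D c H) := by
            refine Finset.sum_congr rfl fun b _ => Finset.sum_congr rfl fun c _ => ?_
            rw [derivation_inverse hl l b c, neg_mul, neg_mul, Finset.sum_mul, Finset.sum_mul,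
              ← Finset.sum_neg_distrib]
            refine Finset.sum_congr rfl fun m _ => ?_
            rw [Finset.sum_mul, Finset.sum_mul, ← Finset.sum_neg_distrib]
            exact Finset.sum_congr rfl fun n _ => by ring
        _ = ∑ m, ∑ n, ∑ b, ∑ c, -(P b m * D b G) * D l (Ω m n) * (P n c * D c H) := by
            have h1 : ∀ b, ∑ c, ∑ m, ∑ n, -(P b m * D b G) * D l (Ω m n) * (P n c * D c H) =
                ∑ m, ∑ n, ∑ c, -(P b m * D b G) * D l (Ω m n) * (P n c * D c H) := by
              intro b
              rw [Finset.sum_comm]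
              exact Finset.sum_congr rfl fun m _ => Finset.sum_comm
            simp only [h1]
            rw [Finset.sum_comm]
            exact Finset.sum_congr rfl fun m _ => Finset.sum_comm
        _ = _ := by
            refine Finset.sum_congr rfl fun m _ => Finset.sum_congr rfl fun n _ => ?_
            simp only [← Finset.mul_sum, hamiltonian_skew hP, ← Finset.sum_mul,
              Finset.sum_neg_distrib]
            simp only [hamiltonian]
            ring
    rw [e1, e3]
    simp only [hamiltonian_skew hP]
    rw [sub_eq_add_neg, ← Finset.sum_neg_distrib]
    congr 2
    exact Finset.sum_congr rfl fun m _ => by ring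
  rw [bivectorBracket_eq_hamiltonian]
  simp only [key, mul_add, mul_sub, Finset.mul_sum, Finset.sum_add_distrib,
    Finset.sum_sub_distrib, mul_assoc]

/-- The bracket of the inverse of a closed nondegenerate form satisfies the Jacobi identity. -/
theorem bivectorBracket_jacobi (hD : ∀ a b F, D a (D b F) = D b (D a F))
    (hP : ∀ a b, P a b = -P b a) (hl : P * Ω = 1)
    (hΩ : ∀ a b c, D a (Ω b c) + D b (Ω c a) + D c (Ω a b) = 0) (F G H : R) :
    bivectorBracket D P F (bivectorBracket D P G H) +
      bivectorBracket D P G (bivectorBracket D P H F) +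
      bivectorBracket D P H (bivectorBracket D P F G) = 0 := by
  simp only [bivectorBracket_nested hP hl]
  -- Symmetry of the Hessian matches each second-derivative term with one of opposite sign in
  -- another nested bracket.
  have hs : ∀ X Y Z : R, ∑ l, ∑ m, hamiltonian D P X l * hamiltonian D P Y m * D l (D m Z) =
      ∑ l, ∑ m, hamiltonian D P Y l * hamiltonian D P X m * D l (D m Z) := by
    intro X Y Z
    rw [Finset.sum_comm]
    exact Finset.sum_congr rfl fun l _ => Finset.sum_congr rfl fun m _ => by
      rw [hD m l]; ring
  have hc : (∑ l, ∑ m, ∑ n, hamiltonian D P F l * hamiltonian D P G m * hamiltonian D P H n *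
          D l (Ω m n))
      + (∑ l, ∑ m, ∑ n, hamiltonian D P G l * hamiltonian D P H m * hamiltonian D P F n *
          D l (Ω m n))
      + (∑ l, ∑ m, ∑ n, hamiltonian D P H l * hamiltonian D P F m * hamiltonian D P G n *
          D l (Ω m n)) = 0 := by
    -- Rename the summation indices cyclically so that all three sums share one coefficient and
    -- closedness applies termwise.
    have h2 : (∑ l, ∑ m, ∑ n, hamiltonian D P G l * hamiltonian D P H m * hamiltonian D P F n *
          D l (Ω m n)) = ∑ l, ∑ m, ∑ n, hamiltonian D P G m * hamiltonian D P H n *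
          hamiltonian D P F l * D m (Ω n l) := by
      rw [Finset.sum_comm_cycle]
    have h3 : (∑ l, ∑ m, ∑ n, hamiltonian D P H l * hamiltonian D P F m * hamiltonian D P G n *
          D l (Ω m n)) = ∑ l, ∑ m, ∑ n, hamiltonian D P H n * hamiltonian D P F l *
          hamiltonian D P G m * D n (Ω l m) := by
      rw [← Finset.sum_comm_cycle]
    rw [h2, h3]
    simp only [← Finset.sum_add_distrib]
    refine Finset.sum_eq_zero fun l _ => Finset.sum_eq_zero fun m _ =>
      Finset.sum_eq_zero fun n _ => ?_
    linear_combination hamiltonian D P F l * hamiltonian D P G m * hamiltonian D P H n * hΩ l m n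
  rw [hs G F H, hs H G F, hs F H G]
  linear_combination hc

end AbstractJacobi

/-! ### Pullbacks between the function algebras -/

section Pullbacks

variable {𝕜 : Type} [RCLike 𝕜] {d : ℕ} {U : Opens (EuclideanSpace ℝ (Fin d))}

theorem pull_X : pull (𝕜 := 𝕜) (U := U) PowerSeries.X = PowerSeries.X := powerSeries_map_X _

theorem ofPhase_X : ofPhase (𝕜 := 𝕜) (U := U) PowerSeries.X = PowerSeries.X := powerSeries_map_X _

theorem sA_X : sA (𝕜 := 𝕜) (U := U) PowerSeries.X = PowerSeries.X := powerSeries_map_X _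

theorem pull_C (P : Jet 𝕜 U) :
    pull (PowerSeries.C P) = PowerSeries.C (MvPolynomial.rename Sum.inr P) :=
  PowerSeries.map_C _ _

theorem ofPhase_C (P : Phase 𝕜 U) :
    ofPhase (PowerSeries.C P) = PowerSeries.C (MvPolynomial.rename Sum.inl P) :=
  PowerSeries.map_C _ _

theorem sA_C (P : JetPhase 𝕜 U) :
    sA (PowerSeries.C P) = PowerSeries.C (MvPolynomial.aeval
      (Sum.elim (fun i => MvPolynomial.X (i, 0)) MvPolynomial.X :
      Fin d ⊕ JetIdx d → Jet 𝕜 U) P) :=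
  PowerSeries.map_C _ _

theorem sA_coeff (f : SmoothFn 𝕜 U) :
    sA (PowerSeries.C (MvPolynomial.C f)) = PowerSeries.C (MvPolynomial.C f) := by
  rw [sA_C, MvPolynomial.aeval_C]; rfl

theorem sA_momentum (i : Fin d) :
    sA (PowerSeries.C (MvPolynomial.X (Sum.inl i))) = gaugeField (𝕜 := 𝕜) (U := U) i := by
  rw [sA_C, MvPolynomial.aeval_X, Sum.elim_inl, gaugeField]

theorem sA_jet (v : JetIdx d) :
    sA (PowerSeries.C (MvPolynomial.X (Sum.inr v))) =
      (PowerSeries.C (MvPolynomial.X v) : FieldDep 𝕜 U) := by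
  rw [sA_C, MvPolynomial.aeval_X, Sum.elim_inr]

theorem sA_pull (G : FieldDep 𝕜 U) : sA (pull G) = G := by
  ext n : 1
  rw [sA, pull, PowerSeries.coeff_map, PowerSeries.coeff_map]
  change MvPolynomial.aeval _ (MvPolynomial.rename _ (PowerSeries.coeff n G)) = _
  rw [MvPolynomial.aeval_rename, Sum.elim_comp_inr, MvPolynomial.aeval_X_left_apply]

theorem sA_Phi (i : Fin d) : sA (Phi (𝕜 := 𝕜) (U := U) i) = 0 := by
  rw [Phi, map_sub, sA_momentum, sA_pull, sub_self]

theorem momentum_eq (i : Fin d) :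
    (PowerSeries.C (MvPolynomial.X (Sum.inl i)) : PowerSeries (JetPhase 𝕜 U)) =
      Phi i + pull (gaugeField i) := by
  rw [Phi, sub_add_cancel]

theorem jetPhaseD_ofPhase (a : Fin d ⊕ Fin d) (F : PowerSeries (Phase 𝕜 U)) :
    jetPhaseD a (ofPhase F) = ofPhase (phaseD a F) := by
  refine ((isDerivationAlong_jetPhaseD a).comp_hom ofPhase_X).ext_mvPolynomial
    ((isDerivationAlong_phaseD a).hom_comp ofPhase_X) (fun f => ?_) (fun j => ?_) F
  · rw [ofPhase_C, MvPolynomial.rename_C, jetPhaseD_coeff, phaseD_coeff]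
    rcases a with i | i <;> simp [ofPhase_C]
  · rw [ofPhase_C, MvPolynomial.rename_X, jetPhaseD_momentum, phaseD_momentum]
    rcases a with i | i
    · simp
    · simp only [Sum.elim_inr]
      split_ifs <;> simp

theorem jetPhaseD_pull (a : Fin d ⊕ Fin d) (G : FieldDep 𝕜 U) :
    jetPhaseD a (pull G) = Sum.elim (fun i => pull (totalD i G)) (fun _ => 0) a := by
  rcases a with i | i
  · refine ((isDerivationAlong_jetPhaseD _).comp_hom pull_X).ext_mvPolynomial
      ((isDerivationAlong_totalD i).hom_comp pull_X) (fun f => ?_) (fun v => ?_) G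
    · have h := totalD_param i f
      rw [param] at h
      rw [h, pull_C, MvPolynomial.rename_C, jetPhaseD_coeff, param, pull_C, MvPolynomial.rename_C,
        Sum.elim_inl]
    · rw [totalD_jet, pull_C, pull_C, MvPolynomial.rename_X, MvPolynomial.rename_X, jetPhaseD_jet,
        Sum.elim_inl]
  · refine ((isDerivationAlong_jetPhaseD _).comp_hom pull_X).ext_mvPolynomial
      (.zero_map (φ := RingHom.comp (RingHom.id _) pull) ?_) (fun f => ?_) (fun v => ?_) G
    · simp [pull_X]
    · rw [pull_C, MvPolynomial.rename_C, jetPhaseD_coeff, Sum.elim_inr]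
    · rw [pull_C, MvPolynomial.rename_X, jetPhaseD_jet, Sum.elim_inr]

/-! ### Variations of the gauge field -/

theorem isDerivationAlong_vary (Q : Fin d → FieldDep 𝕜 U) :
    IsDerivationAlong (RingHom.id _) (vary Q) :=
  isDerivationAlong_varyBy _

theorem vary_coeff (Q : Fin d → FieldDep 𝕜 U) (f : SmoothFn 𝕜 U) :
    vary Q (PowerSeries.C (MvPolynomial.C f)) = 0 :=
  varyBy_C_C _ f

theorem vary_jet (Q : Fin d → FieldDep 𝕜 U) (v : JetIdx d) :
    vary Q (PowerSeries.C (MvPolynomial.X v)) = iterD totalD v.2 (Q v.1) :=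
  varyBy_C_X _ v

theorem vary_gaugeField (Q : Fin d → FieldDep 𝕜 U) (i : Fin d) : vary Q (gaugeField i) = Q i := by
  rw [gaugeField, vary_jet, iterD_zero]

/-- The variation of functions on `T^*U` depending on the gauge field: it acts on the jets of the
gauge field only. -/
def varyPhase (Q : Fin d → FieldDep 𝕜 U) :
    PowerSeries (JetPhase 𝕜 U) → PowerSeries (JetPhase 𝕜 U) :=
  varyBy (Sum.elim 0 fun v => pull (iterD totalD v.2 (Q v.1)))

theorem isDerivationAlong_varyPhase (Q : Fin d → FieldDep 𝕜 U) :
    IsDerivationAlong (RingHom.id _) (varyPhase Q) :=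
  isDerivationAlong_varyBy _

theorem varyPhase_coeff (Q : Fin d → FieldDep 𝕜 U) (f : SmoothFn 𝕜 U) :
    varyPhase Q (PowerSeries.C (MvPolynomial.C f)) = 0 :=
  varyBy_C_C _ f

theorem varyPhase_momentum (Q : Fin d → FieldDep 𝕜 U) (i : Fin d) :
    varyPhase Q (PowerSeries.C (MvPolynomial.X (Sum.inl i))) = 0 :=
  varyBy_C_X _ (Sum.inl i)

theorem varyPhase_jet (Q : Fin d → FieldDep 𝕜 U) (v : JetIdx d) :
    varyPhase Q (PowerSeries.C (MvPolynomial.X (Sum.inr v))) =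
      pull (iterD totalD v.2 (Q v.1)) :=
  varyBy_C_X _ (Sum.inr v)

theorem varyPhase_pull (Q : Fin d → FieldDep 𝕜 U) (G : FieldDep 𝕜 U) :
    varyPhase Q (pull G) = pull (vary Q G) := by
  refine ((isDerivationAlong_varyPhase Q).comp_hom pull_X).ext_mvPolynomial
    ((isDerivationAlong_vary Q).hom_comp pull_X) (fun f => ?_) (fun v => ?_) G
  · rw [pull_C, MvPolynomial.rename_C, varyPhase_coeff, vary_coeff, map_zero]
  · rw [pull_C, MvPolynomial.rename_X, varyPhase_jet, vary_jet]

/-- The variation moves `A` but not `p`; this sign is what makes the flows tangent to the graph. -/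
theorem varyPhase_Phi (Q : Fin d → FieldDep 𝕜 U) (i : Fin d) :
    varyPhase Q (Phi i) = -pull (Q i) := by
  rw [Phi, (isDerivationAlong_varyPhase Q).sub, varyPhase_momentum, varyPhase_pull,
    vary_gaugeField, zero_sub]

theorem varyPhase_ofPhase (Q : Fin d → FieldDep 𝕜 U) (F : PowerSeries (Phase 𝕜 U)) :
    varyPhase Q (ofPhase F) = 0 := by
  refine ((isDerivationAlong_varyPhase Q).comp_hom ofPhase_X).ext_mvPolynomial
    (.zero_map ?_) (fun f => ?_) (fun v => ?_) F
  · simp [ofPhase_X]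
  · rw [ofPhase_C, MvPolynomial.rename_C, varyPhase_coeff]
  · rw [ofPhase_C, MvPolynomial.rename_X, varyPhase_momentum]

/-- A variation is an evolutionary vector field: it sends `∂^α A` to `D^α Q`, so the shift `α ↦ α +
e_i` on jets matches a further total derivative of `Q`. -/
theorem varyPhase_jetPhaseD (Q : Fin d → FieldDep 𝕜 U) (a : Fin d ⊕ Fin d)
    (F : PowerSeries (JetPhase 𝕜 U)) :
    varyPhase Q (jetPhaseD a F) = jetPhaseD a (varyPhase Q F) := by
  have hQ := isDerivationAlong_varyPhase Q
  have ha := isDerivationAlong_jetPhaseD (𝕜 := 𝕜) (U := U) a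
  rw [← sub_eq_zero]
  refine (hQ.commutator ha).ext_mvPolynomial (.zero_map rfl) (fun f => ?_) (fun v => ?_) F
  · rw [varyPhase_coeff, ha.zero, jetPhaseD_coeff]
    rcases a with i | i
    · rw [Sum.elim_inl, varyPhase_coeff, sub_zero]
    · rw [Sum.elim_inr, hQ.zero, sub_zero]
  · rcases v with j | v
    · rw [varyPhase_momentum, ha.zero, jetPhaseD_momentum, sub_zero]
      rcases a with i | i
      · rw [Sum.elim_inl, hQ.zero]
      · rw [Sum.elim_inr]
        split_ifs
        · have := hQ.mul 1 1
          simpa using this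
        · exact hQ.zero
    · rw [varyPhase_jet, jetPhaseD_jet, jetPhaseD_pull]
      rcases a with i | i
      · rw [Sum.elim_inl, Sum.elim_inl, varyPhase_jet, iterD_add_single _ totalD_comm, sub_self]
      · rw [Sum.elim_inr, Sum.elim_inr, hQ.zero, sub_zero]

/-- Restriction of a partial derivative to the graph of the gauge field. -/
theorem sA_jetPhaseD (a : Fin d ⊕ Fin d) (F : PowerSeries (JetPhase 𝕜 U)) :
    sA (jetPhaseD a F) = sA (jetPhaseD a (pull (sA F))) +
      ∑ j, sA (jetPhaseD a (Phi j)) * sA (pDeriv j F) := by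
  have ha := isDerivationAlong_jetPhaseD (𝕜 := 𝕜) (U := U) a
  have h1 : IsDerivationAlong (sA (𝕜 := 𝕜) (U := U)) fun F => sA (jetPhaseD a F) :=
    ha.hom_comp sA_X
  have h2 : IsDerivationAlong (sA (𝕜 := 𝕜) (U := U)) fun F => sA (jetPhaseD a (pull (sA F))) := by
    have h := h1.comp_hom (χ := pull.comp sA) (by simp [sA_X, pull_X])
    have he : (sA.comp (pull.comp sA) : PowerSeries (JetPhase 𝕜 U) →+* _) = sA :=
      RingHom.ext fun F => by simp [sA_pull]
    rw [he] at h
    exact h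
  have h3 : IsDerivationAlong (sA (𝕜 := 𝕜) (U := U))
      fun F => ∑ j, sA (jetPhaseD (𝕜 := 𝕜) (U := U) a (Phi j)) * sA (pDeriv j F) :=
    .sum_map sA_X _ fun j =>
      ((isDerivationAlong_jetPhaseD (Sum.inr j)).hom_comp sA_X).mul_left _
  -- Both sides are derivations along `sA`. Only the momenta need the correction sum, through `p_k =
  -- Φ_k + A_k`.
  refine h1.ext_mvPolynomial (h2.add_map h3) (fun f => ?_) (fun v => ?_) F
  · have : pull (sA (PowerSeries.C (MvPolynomial.C f))) =
        (PowerSeries.C (MvPolynomial.C f) : PowerSeries (JetPhase 𝕜 U)) := by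
      rw [sA_coeff, pull_C, MvPolynomial.rename_C]
    simp only [this, pDeriv, jetPhaseD_coeff (Sum.inr _), Sum.elim_inr, map_zero, mul_zero,
      Finset.sum_const_zero, add_zero]
  · rcases v with k | v
    · have : ∀ j, sA (pDeriv j (PowerSeries.C (MvPolynomial.X (Sum.inl k)))) =
          (if j = k then 1 else 0 : FieldDep 𝕜 U) := by
        intro j
        rw [pDeriv, jetPhaseD_momentum, Sum.elim_inr]
        split_ifs <;> simp
      simp only [this, mul_ite, mul_one, mul_zero, Finset.sum_ite_eq', Finset.mem_univ, if_true]
      rw [sA_momentum, momentum_eq, ha.add, map_add, add_comm]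
    · have : pull (sA (PowerSeries.C (MvPolynomial.X (Sum.inr v)))) =
          (PowerSeries.C (MvPolynomial.X (Sum.inr v)) : PowerSeries (JetPhase 𝕜 U)) := by
        rw [sA_jet, pull_C, MvPolynomial.rename_X]
      simp only [this, pDeriv, jetPhaseD_jet (Sum.inr _), Sum.elim_inr, map_zero, mul_zero,
        Finset.sum_const_zero, add_zero]

/-- A derivation which is tangent to the graph of the gauge field is determined, after restriction
to this graph, by its action on functions on `U`. -/
theorem sA_eq_of_tangent {E : PowerSeries (JetPhase 𝕜 U) → PowerSeries (JetPhase 𝕜 U)}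
    (hE : IsDerivationAlong (RingHom.id _) E) (hΦ : ∀ i, sA (E (Phi i)) = 0)
    (F : PowerSeries (JetPhase 𝕜 U)) : sA (E F) = sA (E (pull (sA F))) := by
  have h1 : IsDerivationAlong (sA (𝕜 := 𝕜) (U := U)) fun F => sA (E F) :=
    hE.hom_comp sA_X
  have h2 : IsDerivationAlong (sA (𝕜 := 𝕜) (U := U)) fun F => sA (E (pull (sA F))) := by
    have h := h1.comp_hom (χ := pull.comp sA) (by simp [sA_X, pull_X])
    have he : (sA.comp (pull.comp sA) : PowerSeries (JetPhase 𝕜 U) →+* _) = sA :=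
      RingHom.ext fun F => by simp [sA_pull]
    rw [he] at h
    exact h
  refine h1.ext_mvPolynomial h2 (fun f => ?_) (fun v => ?_) F
  · rw [sA_coeff, pull_C, MvPolynomial.rename_C]
  · rcases v with k | v
    · rw [sA_momentum, momentum_eq, hE.add, map_add, hΦ, zero_add]
    · rw [sA_jet, pull_C, MvPolynomial.rename_X]

end Pullbacks

section Bracket

variable {𝕜 : Type} [RCLike 𝕜] {d : ℕ} {U : Opens (EuclideanSpace ℝ (Fin d))}

/-! ### The inverse of the symplectic form -/

theorem canonicalForm_mul :
    canonicalForm (𝕜 := 𝕜) (U := U) * Matrix.fromBlocks 0 1 (-1) 0 = 1 := by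
  rw [canonicalForm, Matrix.fromBlocks_multiply]
  simp

variable {Θ : AlmostPoisson 𝕜 U} (W : SymplecticEmbedding Θ)

theorem form_map_constantCoeff :
    W.form.map (PowerSeries.constantCoeff (R := Phase 𝕜 U)) = canonicalForm := Matrix.ext W.deformation

/-- A power series is a unit as soon as its constant term is, and at `t = 0` the determinant is that
of the invertible canonical form. -/
theorem isUnit_det_form : IsUnit W.form.det := by
  rw [PowerSeries.isUnit_iff_constantCoeff, RingHom.map_det, RingHom.mapMatrix_apply,
    form_map_constantCoeff, ← Matrix.isUnit_iff_isUnit_det]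
  exact IsUnit.of_mul_eq_one _ canonicalForm_mul

theorem form_inv_mul : W.form⁻¹ * W.form = 1 := Matrix.nonsing_inv_mul _ (isUnit_det_form W)

theorem form_inv_skew (a b : Fin d ⊕ Fin d) : W.form⁻¹ a b = -W.form⁻¹ b a := by
  have h1 : W.form.transpose = -W.form := by
    ext a b : 2
    rw [Matrix.transpose_apply, Matrix.neg_apply, W.skew]
  have h2 : (-W.form)⁻¹ = -W.form⁻¹ :=
    Matrix.inv_eq_left_inv (by rw [neg_mul_neg, form_inv_mul])
  have h3 := Matrix.transpose_nonsing_inv W.form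
  rw [h1, h2] at h3
  exact congrFun (congrFun h3 b) a

/-- Setting `t = 0` is a ring homomorphism, hence carries the inverse matrix to the inverse of the
canonical one. -/
theorem constantCoeff_form_inv (a b : Fin d ⊕ Fin d) :
    PowerSeries.constantCoeff (W.form⁻¹ a b) =
      (Matrix.fromBlocks 0 1 (-1) 0 : Matrix _ _ (Phase 𝕜 U)) a b := by
  have h := congrArg (fun M => Matrix.map M (PowerSeries.constantCoeff (R := Phase 𝕜 U)))
    (form_inv_mul W)
  simp only [Matrix.map_mul, form_map_constantCoeff] at h
  rw [Matrix.map_one _ (map_zero _) (map_one _)] at h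
  exact congrArg (fun M => M a b) (left_inv_eq_right_inv h canonicalForm_mul)

theorem X_dvd_form_inv_base (i j : Fin d) :
    PowerSeries.X ∣ W.form⁻¹ (Sum.inl i) (Sum.inl j) := by
  rw [PowerSeries.X_dvd_iff, constantCoeff_form_inv, Matrix.fromBlocks_apply₁₁, Matrix.zero_apply]

theorem X_dvd_form_inv_mixed (i j : Fin d) :
    PowerSeries.X ∣ W.form⁻¹ (Sum.inl i) (Sum.inr j) - (if i = j then 1 else 0) := by
  rw [PowerSeries.X_dvd_iff, map_sub, constantCoeff_form_inv, Matrix.fromBlocks_apply₁₂,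
    Matrix.one_apply]
  split_ifs <;> simp

theorem X_sq_dvd_form_inv_base (i j : Fin d) :
    PowerSeries.X ^ 2 ∣ W.form⁻¹ (Sum.inl i) (Sum.inl j) -
      PowerSeries.X * PowerSeries.C (MvPolynomial.C (Θ.θ i j)) := by
  rw [PowerSeries.X_pow_dvd_iff]
  intro m hm
  interval_cases m
  · have := PowerSeries.X_dvd_iff.1 (X_dvd_form_inv_base W i j)
    simpa using this
  · rw [map_sub, W.leading, PowerSeries.coeff_succ_X_mul]
    simp

/-! ### Properties of the bracket on `T^*U` -/

/-- The dependence of the arguments on `A(x)` is harmless: the derivatives along `z` still commute,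
and the form, being independent of `A`, stays closed by `jetPhaseD_ofPhase`. -/
theorem br_jacobi (F G H : PowerSeries (JetPhase 𝕜 U)) :
    W.br F (W.br G H) + W.br G (W.br H F) + W.br H (W.br F G) = 0 := by
  refine bivectorBracket_jacobi (P := W.form⁻¹.map ofPhase) (Ω := W.form.map ofPhase)
    (D := fun a => derivationOfLeibniz (jetPhaseD a) (isDerivationAlong_jetPhaseD a).add
      (isDerivationAlong_jetPhaseD a).mul) jetPhaseD_comm ?_ ?_ ?_ F G H
  · intro a b
    rw [Matrix.map_apply, Matrix.map_apply, form_inv_skew, map_neg]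
  · rw [← Matrix.map_mul, form_inv_mul, Matrix.map_one _ (map_zero _) (map_one _)]
  · intro a b c
    change jetPhaseD a (ofPhase (W.form b c)) + jetPhaseD b (ofPhase (W.form c a)) +
      jetPhaseD c (ofPhase (W.form a b)) = 0
    rw [jetPhaseD_ofPhase, jetPhaseD_ofPhase, jetPhaseD_ofPhase, ← map_add, ← map_add, W.closed,
      map_zero]

theorem br_skew (F G : PowerSeries (JetPhase 𝕜 U)) : W.br F G = -W.br G F := by
  simp only [SymplecticEmbedding.br]
  rw [Finset.sum_comm, ← Finset.sum_neg_distrib]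
  refine Finset.sum_congr rfl fun a _ => ?_
  rw [← Finset.sum_neg_distrib]
  refine Finset.sum_congr rfl fun b _ => ?_
  rw [form_inv_skew, map_neg]
  ring

theorem isDerivationAlong_br (F : PowerSeries (JetPhase 𝕜 U)) :
    IsDerivationAlong (RingHom.id _) (W.br F) :=
  .sum_map rfl _ fun _ => .sum_map rfl _ fun b => (isDerivationAlong_jetPhaseD b).mul_left _

theorem br_add_left (F G H : PowerSeries (JetPhase 𝕜 U)) :
    W.br (F + G) H = W.br F H + W.br G H := by
  rw [br_skew, (isDerivationAlong_br W H).add, br_skew W F, br_skew W G]; ring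

theorem br_sub_left (F G H : PowerSeries (JetPhase 𝕜 U)) :
    W.br (F - G) H = W.br F H - W.br G H := by
  rw [br_skew, (isDerivationAlong_br W H).sub, br_skew W F, br_skew W G]; ring

/-- The coefficients of the bivector do not involve `A`, and variations commute with the partial
derivatives. -/
theorem varyPhase_br (Q : Fin d → FieldDep 𝕜 U) (F G : PowerSeries (JetPhase 𝕜 U)) :
    varyPhase Q (W.br F G) = W.br (varyPhase Q F) G + W.br F (varyPhase Q G) := by
  have h := isDerivationAlong_varyPhase Q
  simp only [SymplecticEmbedding.br, h.sum, h.mul, varyPhase_ofPhase, varyPhase_jetPhaseD,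
    RingHom.id_apply, mul_zero, add_zero, ← Finset.sum_add_distrib]
  exact Finset.sum_congr rfl fun a _ => Finset.sum_congr rfl fun b _ => by ring

theorem sA_br (F G : PowerSeries (JetPhase 𝕜 U)) :
    sA (W.br F G) =
      ∑ a, ∑ b, sA (ofPhase (W.form⁻¹ a b)) * sA (jetPhaseD a F) * sA (jetPhaseD b G) := by
  simp only [SymplecticEmbedding.br, map_sum, map_mul]

/-- On the graph of the gauge field the bracket with `F` only depends on the restriction of `F`
and of its fibre derivatives. -/
theorem sA_br_eq (F G : PowerSeries (JetPhase 𝕜 U)) :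
    sA (W.br F G) = sA (W.br (pull (sA F)) G) + ∑ j, sA (pDeriv j F) * sA (W.br (Phi j) G) := by
  rw [sA_br, sA_br]
  simp only [sA_br]
  exact sum_bilinear_eq _ _ _ _ _ (fun j a => sA (jetPhaseD a (Phi j))) fun a => sA_jetPhaseD a F

theorem isDerivationAlong_pDeriv (i : Fin d) :
    IsDerivationAlong (RingHom.id _) (pDeriv (𝕜 := 𝕜) (U := U) i) :=
  isDerivationAlong_jetPhaseD (Sum.inr i)

theorem pDeriv_pull (i : Fin d) (G : FieldDep 𝕜 U) : pDeriv i (pull G) = 0 :=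
  jetPhaseD_pull (Sum.inr i) G

theorem pDeriv_Phi (i j : Fin d) :
    pDeriv i (Phi (𝕜 := 𝕜) (U := U) j) = if i = j then 1 else 0 := by
  rw [Phi, (isDerivationAlong_pDeriv i).sub, pDeriv_pull, sub_zero, pDeriv, jetPhaseD_momentum,
    Sum.elim_inr]

/-! ### Multipliers -/

variable (L : Fin d → Fin d → FieldDep 𝕜 U)

theorem isDerivationAlong_multiplier (i : Fin d) :
    IsDerivationAlong (RingHom.id _) (fun G => multiplier L G i) :=
  .sum_map rfl _ fun j => (isDerivationAlong_totalD j).mul_left _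

/-- By the Leibniz rule the terms in which the bracket hits a multiplier keep a factor `Φ` and
vanish on the graph. -/
theorem sA_br_PhiL (F : PowerSeries (JetPhase 𝕜 U)) (G : FieldDep 𝕜 U) :
    sA (W.br F (PhiL L G)) = ∑ j, multiplier L G j * sA (W.br F (Phi j)) := by
  rw [PhiL, (isDerivationAlong_br W F).sum, map_sum]
  refine Finset.sum_congr rfl fun j _ => ?_
  rw [(isDerivationAlong_br W F).mul, RingHom.id_apply, RingHom.id_apply, map_add, map_mul,
    map_mul, sA_pull, sA_Phi, zero_mul, add_zero]

theorem sA_PhiL (G : FieldDep 𝕜 U) : sA (PhiL L G) = 0 := by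
  rw [PhiL, map_sum]
  exact Finset.sum_eq_zero fun j _ => by rw [map_mul, sA_Phi, mul_zero]

theorem sA_pDeriv_sum_mul_Phi (i : Fin d) (c : Fin d → PowerSeries (JetPhase 𝕜 U)) :
    sA (pDeriv i (∑ j, c j * Phi j)) = sA (c i) := by
  have h := isDerivationAlong_pDeriv (𝕜 := 𝕜) (U := U) i
  rw [h.sum, map_sum, Finset.sum_eq_single i]
  · rw [h.mul, pDeriv_Phi, if_pos rfl]
    simp [sA_Phi]
  · intro j _ hj
    rw [h.mul, pDeriv_Phi, if_neg hj.symm]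
    simp [sA_Phi]
  · simp

theorem sA_pDeriv_PhiL (i : Fin d) (G : FieldDep 𝕜 U) :
    sA (pDeriv i (PhiL L G)) = multiplier L G i := by
  rw [PhiL, sA_pDeriv_sum_mul_Phi, sA_pull]

/-- In contrast to `sA_br_PhiL`, the fibre derivative can fall on the remaining factor `Φ j`, so the
bracket with the `i`-th multiplier survives. -/
theorem sA_pDeriv_br_PhiL (i : Fin d) (F : PowerSeries (JetPhase 𝕜 U)) (G : FieldDep 𝕜 U) :
    sA (pDeriv i (W.br F (PhiL L G))) =
      ∑ j, multiplier L G j * sA (pDeriv i (W.br F (Phi j))) +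
        sA (W.br F (pull (multiplier L G i))) := by
  have h := isDerivationAlong_pDeriv (𝕜 := 𝕜) (U := U) i
  have hb := isDerivationAlong_br W F
  have e : W.br F (PhiL L G) = ∑ j, pull (multiplier L G j) * W.br F (Phi j) +
      ∑ j, W.br F (pull (multiplier L G j)) * Phi j := by
    rw [PhiL, hb.sum, ← Finset.sum_add_distrib]
    refine Finset.sum_congr rfl fun j _ => ?_
    rw [hb.mul, RingHom.id_apply, RingHom.id_apply]
    ring
  rw [e, h.add, map_add, sA_pDeriv_sum_mul_Phi, h.sum, map_sum]
  congr 1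
  refine Finset.sum_congr rfl fun j _ => ?_
  rw [h.mul, pDeriv_pull, mul_zero, add_zero, RingHom.id_apply, map_mul, sA_pull]

/-- The function `π^*f + Φ_A(L_f)` generating the gauge variation of `f`. -/
def gaugeHamiltonian (G : FieldDep 𝕜 U) : PowerSeries (JetPhase 𝕜 U) := pull G + PhiL L G

theorem sA_gaugeHamiltonian (G : FieldDep 𝕜 U) : sA (gaugeHamiltonian L G) = G := by
  rw [gaugeHamiltonian, map_add, sA_pull, sA_PhiL, add_zero]

/-- The generating function restricts to `G` and has the multipliers as fibre derivatives, so
`sA_br_eq` applies. Here the variation depends on a bracketed function only through these two data,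
as closure requires. -/
theorem gaugeVariation_eq (G : FieldDep 𝕜 U) (i : Fin d) :
    gaugeVariation W L G i =
      sA (W.br (pull G) (Phi i)) + ∑ j, multiplier L G j * sA (W.br (Phi j) (Phi i)) := by
  change sA (W.br (gaugeHamiltonian L G) (Phi i)) = _
  rw [sA_br_eq, sA_gaugeHamiltonian]
  congr 1
  refine Finset.sum_congr rfl fun j _ => ?_
  rw [gaugeHamiltonian, (isDerivationAlong_pDeriv j).add, pDeriv_pull, zero_add, sA_pDeriv_PhiL]

/-! ### The tangent derivations and their curvature -/

/-- The derivation `δ_f + {π^*f + Φ_A(L_f), ·}`, which is tangent to the graph of the gauge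
field. -/
def gaugeFlow (G : FieldDep 𝕜 U) (F : PowerSeries (JetPhase 𝕜 U)) : PowerSeries (JetPhase 𝕜 U) :=
  varyPhase (gaugeVariation W L G) F + W.br (gaugeHamiltonian L G) F

theorem isDerivationAlong_gaugeFlow (G : FieldDep 𝕜 U) :
    IsDerivationAlong (RingHom.id _) (gaugeFlow W L G) :=
  (isDerivationAlong_varyPhase _).add_map (isDerivationAlong_br W _)

theorem sA_gaugeFlow_Phi (G : FieldDep 𝕜 U) (i : Fin d) : sA (gaugeFlow W L G (Phi i)) = 0 := by
  rw [gaugeFlow, varyPhase_Phi, map_add, map_neg, sA_pull]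
  exact neg_add_cancel _

theorem sA_gaugeFlow (G : FieldDep 𝕜 U) (F : PowerSeries (JetPhase 𝕜 U)) :
    sA (gaugeFlow W L G F) = vary (gaugeVariation W L G) (sA F) +
      sA (W.br (gaugeHamiltonian L G) (pull (sA F))) := by
  rw [sA_eq_of_tangent (isDerivationAlong_gaugeFlow W L G) (sA_gaugeFlow_Phi W L G), gaugeFlow,
    varyPhase_pull, map_add, sA_pull]

/-- The generating function of the commutator of two tangent derivations. -/
def curvature (F G : FieldDep 𝕜 U) : PowerSeries (JetPhase 𝕜 U) :=
  varyPhase (gaugeVariation W L F) (gaugeHamiltonian L G)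
    - varyPhase (gaugeVariation W L G) (gaugeHamiltonian L F)
    + W.br (gaugeHamiltonian L F) (gaugeHamiltonian L G)

/-- The commutator of the variations along two gauge directions. -/
def variationCommutator (F G : FieldDep 𝕜 U) (H : PowerSeries (JetPhase 𝕜 U)) :
    PowerSeries (JetPhase 𝕜 U) :=
  varyPhase (gaugeVariation W L F) (varyPhase (gaugeVariation W L G) H)
    - varyPhase (gaugeVariation W L G) (varyPhase (gaugeVariation W L F) H)

/-- Commuting a variation past a bracket varies its generating function, and the Jacobi identity
turns the commutator of two Hamiltonian actions into a single one. -/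
theorem gaugeFlow_commutator (F G : FieldDep 𝕜 U) (H : PowerSeries (JetPhase 𝕜 U)) :
    gaugeFlow W L F (gaugeFlow W L G H) - gaugeFlow W L G (gaugeFlow W L F H) =
      variationCommutator W L F G H + W.br (curvature W L F G) H := by
  have hj := br_jacobi W (gaugeHamiltonian L F) (gaugeHamiltonian L G) H
  rw [br_skew W H (gaugeHamiltonian L F), (isDerivationAlong_br W _).neg, br_skew W H (W.br _ _)]
    at hj
  simp only [gaugeFlow, curvature, variationCommutator, (isDerivationAlong_varyPhase _).add,
    (isDerivationAlong_br W _).add, varyPhase_br, br_add_left, br_sub_left]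
  linear_combination hj

/-- The triple brackets vanish by Jacobi and the terms with one variation and one bracket cancel by
skew-symmetry; only the second variations remain. -/
theorem curvature_bianchi (F G H : FieldDep 𝕜 U) :
    gaugeFlow W L H (curvature W L F G) + gaugeFlow W L F (curvature W L G H)
      + gaugeFlow W L G (curvature W L H F) =
    variationCommutator W L F G (gaugeHamiltonian L H)
      + variationCommutator W L G H (gaugeHamiltonian L F)
      + variationCommutator W L H F (gaugeHamiltonian L G) := by
  have hj := br_jacobi W (gaugeHamiltonian L F) (gaugeHamiltonian L G) (gaugeHamiltonian L H)
  simp only [gaugeFlow, curvature, variationCommutator, (isDerivationAlong_varyPhase _).add,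
    (isDerivationAlong_varyPhase _).sub, (isDerivationAlong_br W _).add,
    (isDerivationAlong_br W _).sub, varyPhase_br]
  rw [br_skew W (varyPhase _ _) (gaugeHamiltonian L F),
    br_skew W (varyPhase _ _) (gaugeHamiltonian L G),
    br_skew W (varyPhase _ _) (gaugeHamiltonian L H)]
  linear_combination hj

theorem variationCommutator_Phi (F G : FieldDep 𝕜 U) (i : Fin d) :
    variationCommutator W L F G (Phi i) =
      -pull (vary (gaugeVariation W L F) (gaugeVariation W L G i)
        - vary (gaugeVariation W L G) (gaugeVariation W L F i)) := by
  rw [variationCommutator, varyPhase_Phi, varyPhase_Phi, (isDerivationAlong_varyPhase _).neg,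
    (isDerivationAlong_varyPhase _).neg, varyPhase_pull, varyPhase_pull, map_sub]
  ring

theorem vary_commutator (F G : FieldDep 𝕜 U) (i : Fin d) :
    vary (gaugeVariation W L F) (gaugeVariation W L G i)
        - vary (gaugeVariation W L G) (gaugeVariation W L F i) =
      sA (W.br (curvature W L F G) (Phi i)) := by
  -- The inner flow of a constraint vanishes on the graph, and a tangent flow preserves this
  -- vanishing.
  have hvan : ∀ F G : FieldDep 𝕜 U, sA (gaugeFlow W L F (gaugeFlow W L G (Phi i))) = 0 := by
    intro F G
    rw [sA_eq_of_tangent (isDerivationAlong_gaugeFlow W L F) (sA_gaugeFlow_Phi W L F),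
      sA_gaugeFlow_Phi, map_zero, (isDerivationAlong_gaugeFlow W L F).zero, map_zero]
  have h := congrArg sA (gaugeFlow_commutator W L F G (Phi i))
  rw [map_sub, hvan, hvan, variationCommutator_Phi, map_add, map_neg, sA_pull] at h
  linear_combination h

/-- A commutator of variations is a derivation killing the field independent `π^*f`; on the graph
only its action on the constraints survives. -/
theorem sA_variationCommutator_gaugeHamiltonian (F G : FieldDep 𝕜 U) (f : SmoothFn 𝕜 U) :
    sA (variationCommutator W L F G (gaugeHamiltonian L (param f))) =
      -∑ i, multiplier L (param f) i *
        (vary (gaugeVariation W L F) (gaugeVariation W L G i)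
          - vary (gaugeVariation W L G) (gaugeVariation W L F i)) := by
  have h : IsDerivationAlong (RingHom.id _) (variationCommutator W L F G) :=
    (isDerivationAlong_varyPhase _).commutator (isDerivationAlong_varyPhase _)
  have hp : ∀ Q : Fin d → FieldDep 𝕜 U, varyPhase Q (pull (param f)) = 0 := fun Q => by
    rw [varyPhase_pull, param, vary_coeff, map_zero]
  have h0 : variationCommutator W L F G (pull (param f)) = 0 := by
    rw [variationCommutator, hp, hp, (isDerivationAlong_varyPhase _).zero,
      (isDerivationAlong_varyPhase _).zero, sub_zero]
  rw [gaugeHamiltonian, h.add, h0, zero_add, PhiL, h.sum, map_sum, ← Finset.sum_neg_distrib]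
  refine Finset.sum_congr rfl fun i _ => ?_
  rw [h.mul, variationCommutator_Phi, RingHom.id_apply, RingHom.id_apply, map_add, map_mul,
    map_mul, map_neg, sA_pull, sA_pull, sA_Phi]
  ring

/-! ### The curvature to first order along the graph -/

theorem varyPhase_gaugeHamiltonian_param (Q : Fin d → FieldDep 𝕜 U) (g : SmoothFn 𝕜 U) :
    varyPhase Q (gaugeHamiltonian L (param g)) =
      ∑ i, pull (vary Q (multiplier L (param g) i)) * Phi i
        - ∑ i, pull (multiplier L (param g) i * Q i) := by
  have h := isDerivationAlong_varyPhase Q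
  rw [gaugeHamiltonian, h.add, varyPhase_pull, param, vary_coeff, map_zero, zero_add, PhiL, h.sum,
    ← Finset.sum_sub_distrib]
  refine Finset.sum_congr rfl fun i _ => ?_
  rw [h.mul, varyPhase_pull, varyPhase_Phi, RingHom.id_apply, RingHom.id_apply, map_mul]
  ring

theorem sA_varyPhase_gaugeHamiltonian_param (G : FieldDep 𝕜 U) (g : SmoothFn 𝕜 U) :
    sA (varyPhase (gaugeVariation W L G) (gaugeHamiltonian L (param g))) =
      -sA (W.br (gaugeHamiltonian L G) (PhiL L (param g))) := by
  rw [varyPhase_gaugeHamiltonian_param, map_sub, map_sum, map_sum, sA_br_PhiL,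
    Finset.sum_eq_zero (fun i _ => by rw [map_mul, sA_Phi, mul_zero]), zero_sub]
  simp only [sA_pull]
  rfl

/-- Each varied generating function restricts to minus a bracket with `Φ(L)`. These cancel the mixed
brackets of `{H_f, H_g}` and reverse the sign of `{Φ(L_f), Φ(L_g)}`. -/
theorem sA_curvature (f g : SmoothFn 𝕜 U) :
    sA (curvature W L (param f) (param g)) = scaledBracket W L (param f) (param g) := by
  rw [curvature, map_add, map_sub, sA_varyPhase_gaugeHamiltonian_param,
    sA_varyPhase_gaugeHamiltonian_param, scaledBracket]
  simp only [gaugeHamiltonian, br_add_left, (isDerivationAlong_br W _).add, map_add]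
  rw [br_skew W (pull (param g)) (PhiL L (param f)),
    br_skew W (PhiL L (param g)) (PhiL L (param f)), map_neg, map_neg]
  ring

theorem sA_pDeriv_varyPhase_gaugeHamiltonian (Q : Fin d → FieldDep 𝕜 U) (g : SmoothFn 𝕜 U)
    (i : Fin d) : sA (pDeriv i (varyPhase Q (gaugeHamiltonian L (param g)))) =
      vary Q (multiplier L (param g) i) := by
  have h := isDerivationAlong_pDeriv (𝕜 := 𝕜) (U := U) i
  rw [varyPhase_gaugeHamiltonian_param, h.sub, map_sub, sA_pDeriv_sum_mul_Phi, sA_pull, h.sum,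
    Finset.sum_eq_zero (fun j _ => pDeriv_pull i _), map_zero, sub_zero]

/-- The fibre derivatives of the curvature are the right-hand side of the recursion. -/
theorem sA_pDeriv_curvature (f g : SmoothFn 𝕜 U) (i : Fin d) :
    sA (pDeriv i (curvature W L (param f) (param g))) =
      recursionRHS W L (param f) (param g) i := by
  have h := isDerivationAlong_pDeriv (𝕜 := 𝕜) (U := U) i
  -- `sA_pDeriv_br_PhiL` expands only the second slot; skew-symmetry moves `Φ(L_f)` there.
  have hk : ∀ k, multiplier L (param g) k * sA (pDeriv i (W.br (PhiL L (param f)) (Phi k))) =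
      ∑ j, multiplier L (param f) j * multiplier L (param g) k *
        sA (pDeriv i (W.br (Phi j) (Phi k)))
      + multiplier L (param g) k * sA (W.br (pull (multiplier L (param f) i)) (Phi k)) := by
    intro k
    rw [br_skew, h.neg, map_neg, sA_pDeriv_br_PhiL, br_skew W (Phi k) (pull _), map_neg, neg_add,
      neg_neg, mul_add, ← Finset.sum_neg_distrib, Finset.mul_sum]
    refine congrArg (· + _) (Finset.sum_congr rfl fun j _ => ?_)
    rw [br_skew W (Phi k) (Phi j), h.neg, map_neg, mul_neg, mul_neg, mul_neg, neg_neg,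
      mul_left_comm, mul_assoc]
  have hΦ : sA (pDeriv i (W.br (PhiL L (param f)) (PhiL L (param g)))) =
      ∑ j, ∑ k, multiplier L (param f) j * multiplier L (param g) k *
        sA (pDeriv i (W.br (Phi j) (Phi k)))
      + sA (W.br (pull (multiplier L (param f) i)) (PhiL L (param g)))
      - sA (W.br (pull (multiplier L (param g) i)) (PhiL L (param f))) := by
    rw [sA_pDeriv_br_PhiL, Finset.sum_congr rfl fun k _ => hk k, Finset.sum_add_distrib,
      ← sA_br_PhiL, br_skew W (PhiL L (param f)) (pull _), map_neg, ← sub_eq_add_neg]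
    exact congrArg (· + _ - _) Finset.sum_comm
  rw [curvature, h.add, h.sub, map_add, map_sub, sA_pDeriv_varyPhase_gaugeHamiltonian,
    sA_pDeriv_varyPhase_gaugeHamiltonian, recursionRHS]
  have he : W.br (gaugeHamiltonian L (param f)) (gaugeHamiltonian L (param g)) =
      W.br (pull (param f)) (pull (param g)) + W.br (pull (param f)) (PhiL L (param g))
      - W.br (pull (param g)) (PhiL L (param f)) + W.br (PhiL L (param f)) (PhiL L (param g)) := by
    rw [gaugeHamiltonian, gaugeHamiltonian, br_add_left, (isDerivationAlong_br W _).add,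
      (isDerivationAlong_br W _).add, br_skew W (PhiL L (param f)) (pull (param g)), ← add_assoc,
      ← sub_eq_add_neg]
  rw [he, h.add, h.sub, h.add, map_add, map_sub, map_add, hΦ, sA_pDeriv_br_PhiL,
    sA_pDeriv_br_PhiL]
  simp only [sub_eq_add_neg, neg_add]
  abel

end Bracket

section FirstOrder

variable {𝕜 : Type} [RCLike 𝕜] {d : ℕ} {U : Opens (EuclideanSpace ℝ (Fin d))}

/-! ### First order differential functions -/

/-- Membership in a subalgebra makes stability under sums and products immediate. -/
theorem isFirstOrder_iff {G : FieldDep 𝕜 U} : IsFirstOrder G ↔ ∀ n, PowerSeries.coeff n G ∈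
    MvPolynomial.supported (SmoothFn 𝕜 U) {v : JetIdx d | v.2.degree ≤ 1} := by
  simp only [IsFirstOrder, MvPolynomial.mem_supported]
  exact Iff.rfl

theorem IsFirstOrder.add {G H : FieldDep 𝕜 U} (hG : IsFirstOrder G) (hH : IsFirstOrder H) :
    IsFirstOrder (G + H) := by
  rw [isFirstOrder_iff] at *
  intro n
  rw [map_add]
  exact add_mem (hG n) (hH n)

theorem IsFirstOrder.neg {G : FieldDep 𝕜 U} (hG : IsFirstOrder G) : IsFirstOrder (-G) := by
  rw [isFirstOrder_iff] at *
  intro n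
  rw [map_neg]
  exact neg_mem (hG n)

theorem IsFirstOrder.mul {G H : FieldDep 𝕜 U} (hG : IsFirstOrder G) (hH : IsFirstOrder H) :
    IsFirstOrder (G * H) := by
  rw [isFirstOrder_iff] at *
  intro n
  rw [PowerSeries.coeff_mul]
  exact sum_mem fun m _ => mul_mem (hG _) (hH _)

theorem isFirstOrder_C {P : Jet 𝕜 U}
    (hP : P ∈ MvPolynomial.supported (SmoothFn 𝕜 U) {v : JetIdx d | v.2.degree ≤ 1}) :
    IsFirstOrder (PowerSeries.C P) := by
  rw [isFirstOrder_iff]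
  intro n
  rw [PowerSeries.coeff_C]
  split_ifs
  · exact hP
  · exact zero_mem _

theorem isFirstOrder_zero : IsFirstOrder (0 : FieldDep 𝕜 U) := by
  simpa using isFirstOrder_C (𝕜 := 𝕜) (U := U) (zero_mem _)

theorem isFirstOrder_one : IsFirstOrder (1 : FieldDep 𝕜 U) := by
  simpa using isFirstOrder_C (𝕜 := 𝕜) (U := U) (one_mem _)

theorem isFirstOrder_sum {ι : Type} (s : Finset ι) {G : ι → FieldDep 𝕜 U}
    (h : ∀ i, IsFirstOrder (G i)) : IsFirstOrder (∑ i ∈ s, G i) := by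
  simp only [isFirstOrder_iff] at *
  intro n
  rw [map_sum]
  exact sum_mem fun i _ => h i n

theorem isFirstOrder_param (f : SmoothFn 𝕜 U) : IsFirstOrder (param f) :=
  isFirstOrder_C (Subalgebra.algebraMap_mem _ f)

theorem isFirstOrder_jet {v : JetIdx d} (hv : v.2.degree ≤ 1) :
    IsFirstOrder (PowerSeries.C (MvPolynomial.X v) : FieldDep 𝕜 U) :=
  isFirstOrder_C (Algebra.subset_adjoin (Set.mem_image_of_mem _ hv))

theorem isFirstOrder_sA_ofPhase (F : PowerSeries (Phase 𝕜 U)) :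
    IsFirstOrder (sA (ofPhase F)) := by
  rw [isFirstOrder_iff]
  intro n
  rw [sA, ofPhase, PowerSeries.coeff_map, PowerSeries.coeff_map]
  change MvPolynomial.aeval _ (MvPolynomial.rename _ (PowerSeries.coeff n F)) ∈ _
  rw [MvPolynomial.aeval_rename, Sum.elim_comp_inl]
  induction PowerSeries.coeff n F using MvPolynomial.induction_on with
  | C a => rw [MvPolynomial.aeval_C]; exact Subalgebra.algebraMap_mem _ a
  | add p q hp hq => rw [map_add]; exact add_mem hp hq
  | mul_X p i hp =>
    rw [map_mul, MvPolynomial.aeval_X]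
    exact mul_mem hp (Algebra.subset_adjoin (Set.mem_image_of_mem _ (by simp)))

/-- Differentiating `p_i - A_i` along `x` produces `-∂A`: apart from the multipliers, this is where
first derivatives of `A` enter. -/
theorem isFirstOrder_sA_jetPhaseD_Phi (a : Fin d ⊕ Fin d) (i : Fin d) :
    IsFirstOrder (sA (jetPhaseD (𝕜 := 𝕜) (U := U) a (Phi i))) := by
  rw [Phi, (isDerivationAlong_jetPhaseD a).sub, jetPhaseD_momentum, jetPhaseD_pull]
  rcases a with k | k
  · simp only [Sum.elim_inl, zero_sub, map_neg, sA_pull, gaugeField]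
    rw [totalD_jet]
    exact (isFirstOrder_jet (by simp)).neg
  · simp only [Sum.elim_inr, sub_zero]
    split_ifs
    · rw [map_one]; exact isFirstOrder_one
    · rw [map_zero]; exact isFirstOrder_zero

theorem isFirstOrder_sA_jetPhaseD_param (a : Fin d ⊕ Fin d) (f : SmoothFn 𝕜 U) :
    IsFirstOrder (sA (jetPhaseD a (pull (param f)))) := by
  rw [jetPhaseD_pull]
  rcases a with k | k
  · rw [Sum.elim_inl, sA_pull, totalD_param]; exact isFirstOrder_param _
  · rw [Sum.elim_inr, map_zero]; exact isFirstOrder_zero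

variable {Θ : AlmostPoisson 𝕜 U} (W : SymplecticEmbedding Θ)

theorem isFirstOrder_sA_br {F G : PowerSeries (JetPhase 𝕜 U)}
    (hF : ∀ a, IsFirstOrder (sA (jetPhaseD a F))) (hG : ∀ a, IsFirstOrder (sA (jetPhaseD a G))) :
    IsFirstOrder (sA (W.br F G)) := by
  rw [sA_br]
  exact isFirstOrder_sum _ fun a => isFirstOrder_sum _ fun b =>
    ((isFirstOrder_sA_ofPhase _).mul (hF a)).mul (hG b)

variable {L : Fin d → Fin d → FieldDep 𝕜 U}

theorem isFirstOrder_multiplier_param (hL : ∀ i j, IsFirstOrder (L i j)) (f : SmoothFn 𝕜 U)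
    (i : Fin d) : IsFirstOrder (multiplier L (param f) i) :=
  isFirstOrder_sum _ fun j => (hL i j).mul (by rw [totalD_param]; exact isFirstOrder_param _)

theorem isFirstOrder_gaugeVariation (hL : ∀ i j, IsFirstOrder (L i j)) (f : SmoothFn 𝕜 U)
    (i : Fin d) : IsFirstOrder (gaugeVariation W L (param f) i) := by
  rw [gaugeVariation_eq]
  exact (isFirstOrder_sA_br W (fun a => isFirstOrder_sA_jetPhaseD_param a f)
    fun a => isFirstOrder_sA_jetPhaseD_Phi a i).add
    (isFirstOrder_sum _ fun j => (isFirstOrder_multiplier_param hL f j).mul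
      (isFirstOrder_sA_br W (fun a => isFirstOrder_sA_jetPhaseD_Phi a j)
        fun a => isFirstOrder_sA_jetPhaseD_Phi a i))

variable (L) in
theorem sA_br_PhiL_PhiL (F G : FieldDep 𝕜 U) :
    sA (W.br (PhiL L F) (PhiL L G)) =
      ∑ k, multiplier L G k * ∑ j, multiplier L F j * sA (W.br (Phi j) (Phi k)) := by
  rw [sA_br_PhiL]
  refine Finset.sum_congr rfl fun k _ => ?_
  rw [br_skew, map_neg, sA_br_PhiL, ← Finset.sum_neg_distrib]
  refine congrArg _ (Finset.sum_congr rfl fun j _ => ?_)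
  rw [br_skew, map_neg, mul_neg, neg_neg]

theorem isFirstOrder_gaugeBracket (hL : ∀ i j, IsFirstOrder (L i j)) (f g : SmoothFn 𝕜 U) :
    IsFirstOrder (gaugeBracket W L (param f) (param g)) := by
  have h : IsFirstOrder (scaledBracket W L (param f) (param g)) := by
    rw [scaledBracket, sA_br_PhiL_PhiL, sub_eq_add_neg]
    refine (isFirstOrder_sA_br W (fun a => isFirstOrder_sA_jetPhaseD_param a f)
      fun a => isFirstOrder_sA_jetPhaseD_param a g).add (IsFirstOrder.neg ?_)
    exact isFirstOrder_sum _ fun k => (isFirstOrder_multiplier_param hL g k).mul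
      (isFirstOrder_sum _ fun j => (isFirstOrder_multiplier_param hL f j).mul
      (isFirstOrder_sA_br W (fun a => isFirstOrder_sA_jetPhaseD_Phi a j)
        fun a => isFirstOrder_sA_jetPhaseD_Phi a k))
  intro n
  rw [gaugeBracket, divT, PowerSeries.coeff_mk]
  exact h (n + 1)

/-! ### Linearity and Leibniz rules -/

/-- With this, `𝕜`-linearity of a derivation reduces to its killing constant parameters. -/
theorem smul_eq_param_mul (c : 𝕜) (F : FieldDep 𝕜 U) :
    c • F = param (algebraMap 𝕜 (SmoothFn 𝕜 U) c) * F := by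
  ext n : 1
  rw [param, PowerSeries.coeff_C_mul, PowerSeries.coeff_smul, Algebra.smul_def]
  rfl

theorem IsDerivationAlong.const_smul {D : FieldDep 𝕜 U → FieldDep 𝕜 U}
    (h : IsDerivationAlong (RingHom.id _) D)
    (hc : ∀ c : 𝕜, D (param (algebraMap 𝕜 (SmoothFn 𝕜 U) c)) = 0) (c : 𝕜) (G : FieldDep 𝕜 U) :
    D (c • G) = c • D G := by
  rw [smul_eq_param_mul, smul_eq_param_mul, h.mul, hc, mul_zero, add_zero, RingHom.id_apply]

theorem param_add (f g : SmoothFn 𝕜 U) : param (f + g) = param f + param g := by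
  rw [param, map_add, map_add]; rfl

theorem param_mul (f g : SmoothFn 𝕜 U) : param (f * g) = param f * param g := by
  rw [param, map_mul, map_mul]; rfl

theorem param_smul (c : 𝕜) (f : SmoothFn 𝕜 U) : param (c • f) = c • param f := by
  rw [smul_eq_param_mul, ← param_mul, Algebra.smul_def]

theorem totalD_const (i : Fin d) (c : 𝕜) :
    totalD i (param (algebraMap 𝕜 (SmoothFn 𝕜 U) c)) = 0 := by
  have : pd i (algebraMap 𝕜 (SmoothFn 𝕜 U) c) = 0 :=
    (pdDer (𝕜 := 𝕜) (U := U) i).map_algebraMap c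
  rw [totalD_param, this, param, map_zero, map_zero]

theorem multiplier_const (i : Fin d) (c : 𝕜) :
    multiplier L (param (algebraMap 𝕜 (SmoothFn 𝕜 U) c)) i = 0 := by
  simp only [multiplier, totalD_const, mul_zero, Finset.sum_const_zero]

theorem br_pull_const (F : PowerSeries (JetPhase 𝕜 U)) (c : 𝕜) :
    W.br F (pull (param (algebraMap 𝕜 (SmoothFn 𝕜 U) c))) = 0 := by
  refine Finset.sum_eq_zero fun a _ => Finset.sum_eq_zero fun b _ => ?_
  rw [jetPhaseD_pull]
  rcases b with k | k
  · rw [Sum.elim_inl, totalD_const, map_zero, mul_zero]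
  · rw [Sum.elim_inr, mul_zero]

theorem isDerivationAlong_sA_br_pull (F : PowerSeries (JetPhase 𝕜 U)) :
    IsDerivationAlong (RingHom.id _) (fun G => sA (W.br F (pull G))) := by
  have h := ((isDerivationAlong_br W F).comp_hom pull_X).hom_comp sA_X
  have he : (sA.comp ((RingHom.id _).comp pull) : FieldDep 𝕜 U →+* FieldDep 𝕜 U) =
      RingHom.id _ := RingHom.ext sA_pull
  rw [he] at h
  exact h

variable (L)

theorem isDerivationAlong_gaugeVariation (i : Fin d) :
    IsDerivationAlong (RingHom.id _) (fun G => gaugeVariation W L G i) := by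
  have h1 : IsDerivationAlong (RingHom.id _) fun G => -1 * sA (W.br (Phi i) (pull G)) +
      ∑ j, sA (W.br (Phi j) (Phi i)) * multiplier L G j :=
    ((isDerivationAlong_sA_br_pull W (Phi i)).mul_left (-1)).add_map
      (.sum_map rfl _ fun j => (isDerivationAlong_multiplier L j).mul_left _)
  convert h1 using 2 with G
  rw [gaugeVariation_eq, br_skew, map_neg, neg_one_mul]
  exact congrArg _ (Finset.sum_congr rfl fun j _ => mul_comm _ _)

theorem gaugeVariation_const (i : Fin d) (c : 𝕜) :
    gaugeVariation W L (param (algebraMap 𝕜 (SmoothFn 𝕜 U) c)) i = 0 := by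
  simp only [gaugeVariation_eq, multiplier_const, zero_mul, Finset.sum_const_zero, add_zero]
  rw [br_skew, br_pull_const, neg_zero, map_zero]

/-- Exhibits `G` only in positions where it is acted on by derivations, which gives the Leibniz rule
in the second argument. -/
theorem scaledBracket_eq (F G : FieldDep 𝕜 U) :
    scaledBracket W L F G = sA (W.br (pull F) (pull G)) +
      ∑ j, -sA (W.br (PhiL L F) (Phi j)) * multiplier L G j := by
  rw [scaledBracket, sA_br_PhiL, sub_eq_add_neg, ← Finset.sum_neg_distrib]
  refine congrArg _ (Finset.sum_congr rfl fun j _ => ?_)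
  rw [mul_comm, neg_mul]

theorem isDerivationAlong_scaledBracket (F : FieldDep 𝕜 U) :
    IsDerivationAlong (RingHom.id _) (scaledBracket W L F) := by
  rw [funext (scaledBracket_eq W L F)]
  exact (isDerivationAlong_sA_br_pull W (pull F)).add_map
    (.sum_map rfl _ fun j => (isDerivationAlong_multiplier L j).mul_left _)

theorem scaledBracket_const (F : FieldDep 𝕜 U) (c : 𝕜) :
    scaledBracket W L F (param (algebraMap 𝕜 (SmoothFn 𝕜 U) c)) = 0 := by
  simp only [scaledBracket_eq, multiplier_const, mul_zero, Finset.sum_const_zero, br_pull_const,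
    map_zero, add_zero]

theorem scaledBracket_skew (F G : FieldDep 𝕜 U) :
    scaledBracket W L F G = -scaledBracket W L G F := by
  rw [scaledBracket, scaledBracket, br_skew W (pull F), br_skew W (PhiL L F), map_neg, map_neg]
  ring

/-! ### Behaviour at `t = 0` -/

variable {L}

theorem X_dvd_multiplier (hL : ∀ i j, PowerSeries.constantCoeff (L i j) = 0)
    (G : FieldDep 𝕜 U) (i : Fin d) : PowerSeries.X ∣ multiplier L G i :=
  Finset.dvd_sum fun j _ => (PowerSeries.X_dvd_iff.2 (hL i j)).mul_right _

theorem sA_br_pull_pull (F G : FieldDep 𝕜 U) :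
    sA (W.br (pull F) (pull G)) = ∑ i, ∑ j,
      sA (ofPhase (W.form⁻¹ (Sum.inl i) (Sum.inl j))) * totalD i F * totalD j G := by
  simp only [sA_br, Fintype.sum_sum_type, jetPhaseD_pull, Sum.elim_inl, Sum.elim_inr, map_zero,
    mul_zero, zero_mul, Finset.sum_const_zero, add_zero, sA_pull]

theorem sA_ofPhase_dvd {n : ℕ} {F : PowerSeries (Phase 𝕜 U)} (h : PowerSeries.X ^ n ∣ F) :
    PowerSeries.X ^ n ∣ sA (ofPhase F) := by
  have := map_dvd (sA.comp ofPhase) h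
  rwa [map_pow, RingHom.comp_apply, ofPhase_X, sA_X] at this

/-- Each of the two multipliers contributes a factor `t`, so this term affects neither divisibility
by `t` nor the leading term of the bracket. -/
theorem X_sq_dvd_sA_br_PhiL (hL : ∀ i j, PowerSeries.constantCoeff (L i j) = 0)
    (F G : FieldDep 𝕜 U) : PowerSeries.X ^ 2 ∣ sA (W.br (PhiL L F) (PhiL L G)) := by
  rw [sA_br_PhiL_PhiL, pow_two]
  exact Finset.dvd_sum fun k _ => mul_dvd_mul (X_dvd_multiplier hL G k)
    (Finset.dvd_sum fun j _ => (X_dvd_multiplier hL F j).mul_right _)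

theorem X_dvd_scaledBracket (hL : ∀ i j, PowerSeries.constantCoeff (L i j) = 0)
    (F G : FieldDep 𝕜 U) : PowerSeries.X ∣ scaledBracket W L F G := by
  rw [scaledBracket, sA_br_pull_pull]
  refine dvd_sub (Finset.dvd_sum fun i _ => Finset.dvd_sum fun j _ => ?_)
    ((Dvd.intro_left _ (pow_succ _ 1).symm).trans (X_sq_dvd_sA_br_PhiL W hL F G))
  have h := sA_ofPhase_dvd (n := 1) (by simpa using X_dvd_form_inv_base W i j)
  rw [pow_one] at h
  exact (h.mul_right _).mul_right _

theorem X_mul_gaugeBracket (hL : ∀ i j, PowerSeries.constantCoeff (L i j) = 0)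
    (F G : FieldDep 𝕜 U) :
    PowerSeries.X * gaugeBracket W L F G = scaledBracket W L F G := by
  have h := PowerSeries.X_dvd_iff.1 (X_dvd_scaledBracket W hL F G)
  conv_rhs => rw [PowerSeries.eq_X_mul_shift_add_const (scaledBracket W L F G), h, map_zero,
    add_zero]
  rfl

theorem X_mul_cancel {B : Type} [CommRing B] {F G : PowerSeries B}
    (h : PowerSeries.X * F = PowerSeries.X * G) : F = G := by
  ext n
  have := congrArg (PowerSeries.coeff (n + 1)) h
  rwa [PowerSeries.coeff_succ_X_mul, PowerSeries.coeff_succ_X_mul] at this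

theorem constantCoeff_gaugeBracket (hL : ∀ i j, PowerSeries.constantCoeff (L i j) = 0)
    (f g : SmoothFn 𝕜 U) :
    PowerSeries.constantCoeff (gaugeBracket W L (param f) (param g)) =
      MvPolynomial.C (Θ.bracket f g) := by
  have hθ : PowerSeries.X * param (Θ.bracket f g) = ∑ i, ∑ j,
      (PowerSeries.X * param (Θ.θ i j)) * totalD i (param f) * totalD j (param g) := by
    simp only [totalD_param, mul_assoc, ← param_mul, ← Finset.mul_sum]
    congr 1
    simp only [AlmostPoisson.bracket, param, map_sum, mul_assoc]
  -- Compare modulo `t²`, since the bracket carries an extra factor `t`; there the base block of the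
  -- inverse form is `tθ`.
  have hdvd : PowerSeries.X ^ 2 ∣ PowerSeries.X * gaugeBracket W L (param f) (param g) -
      PowerSeries.X * param (Θ.bracket f g) := by
    rw [X_mul_gaugeBracket W hL, scaledBracket, sub_right_comm]
    refine dvd_sub ?_ (X_sq_dvd_sA_br_PhiL W hL _ _)
    rw [hθ, sA_br_pull_pull, ← Finset.sum_sub_distrib]
    refine Finset.dvd_sum fun i _ => ?_
    rw [← Finset.sum_sub_distrib]
    refine Finset.dvd_sum fun j _ => ?_
    rw [← sub_mul, ← sub_mul]
    have h := sA_ofPhase_dvd (X_sq_dvd_form_inv_base W i j)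
    rw [map_sub, map_sub, map_mul, map_mul, ofPhase_X, sA_X, ofPhase_C, MvPolynomial.rename_C,
      sA_coeff] at h
    exact (h.mul_right _).mul_right _
  rw [← mul_sub] at hdvd
  obtain ⟨c, hc⟩ := hdvd
  rw [pow_two, mul_assoc] at hc
  have h := PowerSeries.X_dvd_iff.1 ⟨c, X_mul_cancel hc⟩
  rw [map_sub, sub_eq_zero] at h
  rw [h, param]
  exact PowerSeries.constantCoeff_C _

theorem constantCoeff_gaugeVariation (hL : ∀ i j, PowerSeries.constantCoeff (L i j) = 0)
    (f : SmoothFn 𝕜 U) (i : Fin d) :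
    PowerSeries.constantCoeff (gaugeVariation W L (param f) i) = MvPolynomial.C (pd i f) := by
  have hdvd : PowerSeries.X ∣ gaugeVariation W L (param f) i - param (pd i f) := by
    rw [gaugeVariation_eq, add_sub_right_comm]
    refine dvd_add ?_ (Finset.dvd_sum fun j _ => (X_dvd_multiplier hL _ j).mul_right _)
    have hbr : sA (W.br (pull (param f)) (Phi i)) =
        ∑ j, ∑ k, sA (ofPhase (W.form⁻¹ (Sum.inl j) (Sum.inl k))) * param (pd j f) *
          sA (jetPhaseD (Sum.inl k) (Phi i)) +
        ∑ j, sA (ofPhase (W.form⁻¹ (Sum.inl j) (Sum.inr i))) * param (pd j f) := by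
      have hΦ : ∀ k, jetPhaseD (𝕜 := 𝕜) (U := U) (Sum.inr k) (Phi i) = if k = i then 1 else 0 :=
        fun k => pDeriv_Phi k i
      simp only [sA_br, Fintype.sum_sum_type, jetPhaseD_pull, Sum.elim_inl, Sum.elim_inr, map_zero,
        mul_zero, zero_mul, Finset.sum_const_zero, add_zero, sA_pull, totalD_param,
        Finset.sum_add_distrib, hΦ]
      congr 1
      refine Finset.sum_congr rfl fun j _ => ?_
      rw [Finset.sum_eq_single i]
      · rw [if_pos rfl, map_one, mul_one]
      · intro k _ hk
        rw [if_neg hk, map_zero, mul_zero]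
      · simp
    -- Modulo `t` the base block vanishes and the mixed block is the identity, so `∂_i f` is written
    -- as a contraction with that identity.
    have hpd : param (pd i f) = ∑ j, (if j = i then 1 else 0) * param (pd j f) := by
      simp
    rw [hbr, hpd, add_sub_assoc, ← Finset.sum_sub_distrib]
    refine dvd_add (Finset.dvd_sum fun j _ => Finset.dvd_sum fun k _ => ?_)
      (Finset.dvd_sum fun j _ => ?_)
    · have h := sA_ofPhase_dvd (n := 1) (by simpa using X_dvd_form_inv_base W j k)
      rw [pow_one] at h
      exact (h.mul_right _).mul_right _
    · rw [← sub_mul]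
      have h := sA_ofPhase_dvd (n := 1) (by simpa using X_dvd_form_inv_mixed W j i)
      rw [pow_one, map_sub, map_sub] at h
      refine Dvd.dvd.mul_right ?_ _
      split_ifs at h ⊢ <;> simpa using h
  have h := PowerSeries.X_dvd_iff.1 hdvd
  rw [map_sub, sub_eq_zero] at h
  rw [h, param]
  exact PowerSeries.constantCoeff_C _

/-! ### Closure and the Jacobi identity -/

/-- This is closure. The two sides agree term by term after `sA_br_eq` and `gaugeVariation_eq`, the
fibre derivatives of the curvature being the multipliers by the recursion. -/
theorem evalAt_vary_commutator (hL : ∀ i j, PowerSeries.constantCoeff (L i j) = 0)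
    (hrec : SatisfiesRecursion W L) (f g : SmoothFn 𝕜 U) (A : Fin d → SmoothFn 𝕜 U) (i : Fin d) :
    evalAt A (vary (gaugeVariation W L (param f)) (gaugeVariation W L (param g) i)
        - vary (gaugeVariation W L (param g)) (gaugeVariation W L (param f) i)) =
      evalAt A (gaugeVariation W L (scaledBracket W L (param f) (param g)) i) := by
  rw [vary_commutator, sA_br_eq, sA_curvature, gaugeVariation_eq, map_add, map_add, map_sum,
    map_sum]
  refine congrArg _ (Finset.sum_congr rfl fun j _ => ?_)
  rw [map_mul, map_mul, sA_pDeriv_curvature, ← hrec, X_mul_gaugeBracket W hL]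

/-- The last term is `L_h^i δ_K A_i`, the correction separating the field dependent bracket from the
Hamiltonian action of `H_h`. -/
theorem scaledBracket_eq_gaugeHamiltonian (h : FieldDep 𝕜 U) (K : FieldDep 𝕜 U) :
    scaledBracket W L h K = sA (W.br (gaugeHamiltonian L h) (pull K)) +
      sA (W.br (gaugeHamiltonian L K) (PhiL L h)) := by
  rw [gaugeHamiltonian, gaugeHamiltonian, br_add_left, br_add_left, map_add, map_add,
    br_skew W (pull K), br_skew W (PhiL L K), map_neg, map_neg, scaledBracket]
  ring

theorem sA_gaugeFlow_curvature (f g h : SmoothFn 𝕜 U) :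
    sA (gaugeFlow W L (param h) (curvature W L (param f) (param g))) =
      vary (gaugeVariation W L (param h)) (scaledBracket W L (param f) (param g)) +
      scaledBracket W L (param h) (scaledBracket W L (param f) (param g)) -
      ∑ i, multiplier L (param h) i *
        gaugeVariation W L (scaledBracket W L (param f) (param g)) i := by
  have hv : ∑ i, multiplier L (param h) i *
      gaugeVariation W L (scaledBracket W L (param f) (param g)) i =
      sA (W.br (gaugeHamiltonian L (scaledBracket W L (param f) (param g)))
        (PhiL L (param h))) := by
    rw [sA_br_PhiL]
    rfl
  rw [sA_gaugeFlow, sA_curvature, hv,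
    scaledBracket_eq_gaugeHamiltonian W (param h) (scaledBracket W L (param f) (param g)),
    ← add_assoc, add_sub_cancel_right]

/-- Closure, contracted with the multipliers; evaluation at `A` is multiplicative, so the pointwise
form of closure suffices. -/
theorem evalAt_sA_variationCommutator (hL : ∀ i j, PowerSeries.constantCoeff (L i j) = 0)
    (hrec : SatisfiesRecursion W L) (f g h : SmoothFn 𝕜 U) (A : Fin d → SmoothFn 𝕜 U) :
    evalAt A (sA (variationCommutator W L (param f) (param g) (gaugeHamiltonian L (param h)))) =
      -evalAt A (∑ i, multiplier L (param h) i *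
        gaugeVariation W L (scaledBracket W L (param f) (param g)) i) := by
  rw [sA_variationCommutator_gaugeHamiltonian, map_neg, map_sum, map_sum]
  refine congrArg _ (Finset.sum_congr rfl fun i _ => ?_)
  rw [map_mul, map_mul, evalAt_vary_commutator W hL hrec]

/-- In the restricted Bianchi identity the corrections `L_h^i δ_{t⟦f,g⟧} A_i` occur with the same
sign on both sides. -/
theorem evalAt_scaledBracket_jacobi (hL : ∀ i j, PowerSeries.constantCoeff (L i j) = 0)
    (hrec : SatisfiesRecursion W L) (f g h : SmoothFn 𝕜 U) (A : Fin d → SmoothFn 𝕜 U) :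
    evalAt A
      ((scaledBracket W L (param h) (scaledBracket W L (param f) (param g))
          + vary (gaugeVariation W L (param h)) (scaledBracket W L (param f) (param g)))
        + (scaledBracket W L (param f) (scaledBracket W L (param g) (param h))
          + vary (gaugeVariation W L (param f)) (scaledBracket W L (param g) (param h)))
        + (scaledBracket W L (param g) (scaledBracket W L (param h) (param f))
          + vary (gaugeVariation W L (param g)) (scaledBracket W L (param h) (param f)))) = 0 := by
  have hb := congrArg (fun F => evalAt A (sA F))
    (curvature_bianchi W L (param f) (param g) (param h))
  simp only [map_add, sA_gaugeFlow_curvature, map_sub,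
    evalAt_sA_variationCommutator W hL hrec] at hb ⊢
  linear_combination hb

theorem evalAt_gaugeBracket_jacobi (hL : ∀ i j, PowerSeries.constantCoeff (L i j) = 0)
    (hrec : SatisfiesRecursion W L) (f g h : SmoothFn 𝕜 U) (A : Fin d → SmoothFn 𝕜 U) :
    evalAt A
      ((PowerSeries.X * gaugeBracket W L (param h) (gaugeBracket W L (param f) (param g))
          + vary (gaugeVariation W L (param h)) (gaugeBracket W L (param f) (param g)))
        + (PowerSeries.X * gaugeBracket W L (param f) (gaugeBracket W L (param g) (param h))
          + vary (gaugeVariation W L (param f)) (gaugeBracket W L (param g) (param h)))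
        + (PowerSeries.X * gaugeBracket W L (param g) (gaugeBracket W L (param h) (param f))
          + vary (gaugeVariation W L (param g)) (gaugeBracket W L (param h) (param f)))) = 0 := by
  -- The nested brackets and the variations are `t`-linear, so the scaled identity is `t` times the
  -- desired one.
  refine X_mul_cancel ?_
  have hX : (PowerSeries.X : PowerSeries (SmoothFn 𝕜 U)) =
      evalAt A (PowerSeries.X : FieldDep 𝕜 U) := (powerSeries_map_X _).symm
  have hs := evalAt_scaledBracket_jacobi W hL hrec f g h A
  simp only [← X_mul_gaugeBracket W hL (param _) (param _),
    (isDerivationAlong_scaledBracket W L _).X_mul, (isDerivationAlong_vary _).X_mul, ← mul_add,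
    map_mul] at hs
  simp only [X_mul_gaugeBracket W hL]
  rw [mul_zero, hX]
  exact hs

end FirstOrder

end

end AlmostPoissonGauge

/-! ### The proposition -/

open AlmostPoissonGauge in
theorem proposition4p2 {𝕜 : Type} [RCLike 𝕜] {d : ℕ}
    (U : TopologicalSpace.Opens (EuclideanSpace ℝ (Fin d)))
    (Θ : AlmostPoisson 𝕜 U) (W : SymplecticEmbedding Θ)
    (L : Fin d → Fin d → FieldDep 𝕜 U)
    (hL_jet : ∀ i j, IsFirstOrder (L i j))
    (hL_zero : ∀ i j, PowerSeries.constantCoeff (L i j) = 0)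
    (hL_rec : SatisfiesRecursion W L) :
    (∀ f g : SmoothFn 𝕜 U,
      PowerSeries.X * gaugeBracket W L (param f) (param g) =
        sA (W.br (pull (param f)) (pull (param g)))
          - sA (W.br (PhiL L (param f)) (PhiL L (param g)))) ∧
    IsAlmostPoissonGauge Θ (gaugeVariation W L) (gaugeBracket W L) := by
  have hX := X_mul_gaugeBracket W hL_zero
  have hδ := isDerivationAlong_gaugeVariation W L
  have hS := isDerivationAlong_scaledBracket W L
  -- Algebraic identities for the bracket are checked after multiplication by `t`, where the
  -- defining formula applies.
  have hskew : ∀ F G, gaugeBracket W L F G = -gaugeBracket W L G F := fun F G =>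
    X_mul_cancel (by rw [mul_neg, hX, hX, scaledBracket_skew])
  have hadd : ∀ F G H, gaugeBracket W L F (G + H) = gaugeBracket W L F G + gaugeBracket W L F H :=
    fun F G H => X_mul_cancel (by rw [mul_add, hX, hX, hX, (hS F).add])
  have hsmul : ∀ (c : 𝕜) F G, gaugeBracket W L F (c • G) = c • gaugeBracket W L F G :=
    fun c F G => X_mul_cancel (by
      rw [mul_smul_comm, hX, hX, (hS F).const_smul (scaledBracket_const W L F)])
  refine ⟨fun f g => hX _ _, ?_⟩
  exact
    { variation_jet := isFirstOrder_gaugeVariation W hL_jet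
      variation_add := fun f g i => by rw [param_add]; exact (hδ i).add _ _
      variation_smul := fun c f i => by
        rw [param_smul]; exact (hδ i).const_smul (gaugeVariation_const W L i) c _
      variation_initial := constantCoeff_gaugeVariation W hL_zero
      variation_leibniz := fun f g i => by
        rw [param_mul, add_comm]; exact (hδ i).mul _ _
      closure := fun f g A i => by
        rw [hX, ← evalAt_vary_commutator W hL_zero hL_rec]
        refine congrArg _ ?_
        -- The terms of order at most one in the variations are symmetric in `f` and `g` and drop
        -- out of the commutator.
        simp only [onePlus, vary_gaugeField, (isDerivationAlong_vary _).add]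
        ring
      bracket_jet := isFirstOrder_gaugeBracket W hL_jet
      bracket_skew := fun f g => hskew _ _
      bracket_add := fun f g h => by
        rw [param_add, hskew, hadd, neg_add, ← hskew, ← hskew]
      bracket_smul := fun c f g => by
        rw [param_smul, hskew, hsmul, ← smul_neg, ← hskew]
      bracket_initial := constantCoeff_gaugeBracket W hL_zero
      bracket_jacobi := evalAt_gaugeBracket_jacobi W hL_zero hL_rec
      bracket_deriv_add := fun f G H => hadd _ _ _
      bracket_deriv_smul := fun c f G => hsmul c _ _
      bracket_deriv_mul := fun f G H => X_mul_cancel (by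
        rw [mul_add, mul_left_comm, mul_left_comm _ G, hX, hX, hX, (hS _).mul, add_comm]
        rfl) }
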